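/- For $n\ge 0$ let $X_n$ be the number of comparisons made by randomized Quicksort on an array of $n$ distinct real numbers: for $n\le 1$ nothing is done and $X_n=0$; for $n\ge 2$ a pivot is chosen uniformly at random from the array, each of the other $n-1$ numbers is compared to it, and the algorithm is run recursively, with independent randomness, on the subarray of the numbers smaller than the pivot and on the subarray of the numbers larger than the pivot. (The law of $X_n$ depends only on $n$.) Let $Y_n=(X_n-\mathbf E X_n)/n$ for $n\ge 1$. **Theorem.** As $n\to\infty$, $Y_n$ converges in distribution to a real random variable $Y$, and the characteristic function $\phi(t)=\mathbf E\,e^{itY}$, $t\in\mathbf R$, of this limit is infinitely differentiable and has the following property. For each real $p\ge 0$ and integer $k\ge 0$ there is a constant $c_{p,k}$ such that $$|\phi^{(k)}(t)|\le c_{p,k}\,|t|^{-p}\qquad\text{for all } t\in\mathbf R$$ (at $t=0$ the right-hand side is read as $c_{0,k}$ if $p=0$ and as $+\infty$ if $p>0$). In other words, $\phi$ belongs to the Schwartz class $\mathcal S(\mathbf R)$ of infinitely differentiable functions that, together with all their derivatives, decrease more rapidly than any power. -/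

import Mathlib

open MeasureTheory ProbabilityTheory Filter Topology
open scoped ContDiff SchwartzMap

/-- The law of the number of comparisons made by (randomized) Quicksort on an array whose entries
are the distinct keys in `s`.  If there is at most one key, nothing is done.  Otherwise a pivot
`p` is drawn uniformly from `s`, the other `s.card - 1` keys are compared to it, and Quicksort is
run, with independent randomness, on the keys below `p` and on the keys above `p`. -/
noncomputable def quicksortComparisons {α : Type*} [LinearOrder α] (s : Finset α) : PMF ℕ :=
  if h : 1 < s.card then
    haveI : Nonempty s := (Finset.card_pos.mp (Nat.zero_lt_of_lt h)).to_subtype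
    (PMF.uniformOfFintype s).bind fun p =>
      (quicksortComparisons (s.filter fun x => x < (p : α))).bind fun a =>
        (quicksortComparisons (s.filter fun x => (p : α) < x)).bind fun b =>
          PMF.pure (a + b + (s.card - 1))
  else PMF.pure 0
termination_by s.card
decreasing_by
  · exact Finset.card_lt_card (Finset.filter_ssubset.mpr ⟨p, p.2, lt_irrefl _⟩)
  · exact Finset.card_lt_card (Finset.filter_ssubset.mpr ⟨p, p.2, lt_irrefl _⟩)

/-- The expected number of comparisons made by Quicksort on the keys in `s`. -/
noncomputable def quicksortMean {α : Type*} [LinearOrder α] (s : Finset α) : ℝ :=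
  ∫ x : ℕ, (x : ℝ) ∂(quicksortComparisons s).toMeasure

/-- The standardized number of comparisons `(X - E X) / n`, as a function of the number `X` of
comparisons, for an array consisting of the `n = s.card` distinct keys in `s`. -/
noncomputable def quicksortStandardized {α : Type*} [LinearOrder α] (s : Finset α) (x : ℕ) : ℝ :=
  ((x : ℝ) - quicksortMean s) / (s.card : ℝ)

/-- `F` is the limiting Quicksort distribution: for arrays of `n` distinct real numbers, the
standardized number of comparisons converges in distribution, as `n → ∞`, to a random variable
with law `F` (the identity on the probability space `(ℝ, F)`). -/
def IsQuicksortLimit (F : ProbabilityMeasure ℝ) : Prop :=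
  ∀ A : ℕ → Finset ℝ, (∀ n, (A n).card = n) →
    TendstoInDistribution (fun n => quicksortStandardized (A n)) atTop (id : ℝ → ℝ)
      (fun n => (quicksortComparisons (A n)).toMeasure) (F : Measure ℝ)

/-! Existence of the limit. Conditioning on the pivot rank gives a recursion for the characteristic
functions `quicksortChar n`. By the closed form of the means, the centered toll divided by n is
close to `tollLimit u` = 1 + 2u log u + 2(1-u) log(1-u), where u is the relative rank. The limiting
recursion is therefore φ = `quicksortOp` φ, with `quicksortOp` φ (t) = ∫₀¹ φ(ut) φ((1-u)t) exp(it
`tollLimit u`) du. In the distance sup |f(t)-h(t)|/t² this operator contracts by ∫ (u²+(1-u)²) du =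
2/3. Iterating from the constant 1 gives a fixed point g, and the same factor, applied to the finite
recursion with vanishing errors, gives `quicksortChar n` → g. Lévy's continuity theorem yields the
limit law. Exponential moments, bounded uniformly in n (`quicksortMGF_le`), pass to the limit, so
all moments are finite and φ is smooth.

Decay. With the values y, z of the two subproblems fixed, the integral over u has a strictly convex
phase, and van der Corput's method bounds it by 6|t|^(-1/2) uniformly in y and z; averaging bounds φ
(`norm_quicksortOp_charFun_le`). Feeding decay back into the fixed-point equation gains another half
power each time (`norm_le_of_quicksortOp_fixedPoint`).

Derivatives. Each derivative is bounded by an absolute moment. A rapidly decreasing function with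
bounded second derivative has a rapidly decreasing first derivative
(`rapidDecay_deriv_of_bounded_deriv_two`), and induction covers every order. -/

/-! ### Integration against finitely supported laws. -/

namespace PMF

variable {α β E : Type*} [MeasurableSpace α] [MeasurableSingletonClass α] [MeasurableSpace β]
  [MeasurableSingletonClass β] [NormedAddCommGroup E] [NormedSpace ℝ E]

omit [NormedSpace ℝ E] in
theorem integrable_of_finite_support {p : PMF α} (hp : p.support.Finite) (f : α → E) :
    Integrable f p.toMeasure := by
  rw [← restrict_toMeasure_support]
  exact IntegrableOn.of_finite hp

variable [CompleteSpace E]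

theorem integral_eq_sum_of_support_subset {p : PMF α} {S : Finset α} (h : p.support ⊆ S)
    (f : α → E) : ∫ a, f a ∂p.toMeasure = ∑ a ∈ S, (p a).toReal • f a := by
  rw [integral_eq_tsum _ _ (integrable_of_finite_support (S.finite_toSet.subset h) f)]
  refine tsum_eq_sum fun a ha => ?_
  have : p a = 0 := by
    by_contra h0
    exact ha (by simpa using h ((p.mem_support_iff a).2 h0))
  simp [this]

theorem integral_bind {p : PMF α} {q : α → PMF β} (hp : p.support.Finite)
    (hq : ∀ a, (q a).support.Finite) (f : β → E) :
    ∫ b, f b ∂(p.bind q).toMeasure = ∫ a, (∫ b, f b ∂(q a).toMeasure) ∂p.toMeasure := by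
  classical
  have hS : p.support ⊆ (hp.toFinset : Set α) := by simp
  set S := hp.toFinset
  set T := S.biUnion fun a => (hq a).toFinset
  have hT : ∀ a ∈ S, (q a).support ⊆ (T : Set β) := by
    intro a ha b hb
    simp only [T, Finset.coe_biUnion, Set.mem_iUnion]
    exact ⟨a, ha, by simpa using hb⟩
  have hT' : (p.bind q).support ⊆ (T : Set β) := by
    rw [support_bind]
    exact Set.iUnion₂_subset fun a ha => hT a (by exact_mod_cast hS ha)
  rw [integral_eq_sum_of_support_subset hT', integral_eq_sum_of_support_subset hS]
  have h1 : ∀ a ∈ S, (p a).toReal • ∫ b, f b ∂(q a).toMeasure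
      = ∑ b ∈ T, ((p a).toReal * (q a b).toReal) • f b := by
    intro a ha
    rw [integral_eq_sum_of_support_subset (hT a ha), Finset.smul_sum]
    simp_rw [mul_smul]
  rw [Finset.sum_congr rfl h1, Finset.sum_comm]
  refine Finset.sum_congr rfl fun b _ => ?_
  rw [← Finset.sum_smul]
  congr 1
  rw [bind_apply, tsum_eq_sum (s := S), ENNReal.toReal_sum]
  · simp [ENNReal.toReal_mul]
  · exact fun a _ => ENNReal.mul_ne_top (p.apply_ne_top a) ((q a).apply_ne_top b)
  · intro a ha
    have : p a = 0 := by
      by_contra h0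
      exact ha (by exact_mod_cast hS ((p.mem_support_iff a).2 h0))
    simp [this]

theorem integral_uniformOfFintype [Fintype α] [Nonempty α] (f : α → E) :
    ∫ a, f a ∂(uniformOfFintype α).toMeasure = (Fintype.card α : ℝ)⁻¹ • ∑ a, f a := by
  rw [integral_eq_sum_of_support_subset (S := Finset.univ) (by simp), Finset.smul_sum]
  simp

theorem integral_pure (a : α) (f : α → E) : ∫ x, f x ∂(pure a).toMeasure = f a := by
  rw [integral_eq_sum_of_support_subset (S := {a}) (by simp)]
  simp

omit [MeasurableSpace α] [MeasurableSingletonClass α] [MeasurableSpace β]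
  [MeasurableSingletonClass β] in
theorem uniformOfFintype_bind_equiv [Fintype α] [Nonempty α] [Fintype β] [Nonempty β] {γ : Type*}
    (e : α ≃ β) (f : β → PMF γ) :
    (uniformOfFintype β).bind f = (uniformOfFintype α).bind fun a => f (e a) := by
  ext c
  rw [bind_apply, bind_apply, ← e.tsum_eq]
  simp [Fintype.card_congr e]

end PMF

/-! ### The law depends only on the number of keys; recursion on the pivot rank. -/

theorem card_filter_eq_card_filter_coe {α : Type*} (u : Finset α) (P : α → Prop)
    [DecidablePred P] : (u.filter P).card = (Finset.univ.filter fun x : u => P x).card := by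
  rw [← Finset.card_map (s := Finset.univ.filter fun x : u => P x)
    (Function.Embedding.subtype (· ∈ u))]
  congr 1
  ext x
  simp [and_comm]

/-- The order isomorphism between the two sets matches pivots of equal rank, hence subarrays of
equal sizes, to which strong induction applies. -/
theorem quicksortComparisons_eq_of_card_eq {α β : Type*} [LinearOrder α] [LinearOrder β]
    (s : Finset α) (t : Finset β) (h : s.card = t.card) :
    quicksortComparisons s = quicksortComparisons t := by
  induction hn : s.card using Nat.strong_induction_on generalizing s t with
  | _ n ih =>
    subst hn
    rw [quicksortComparisons, quicksortComparisons.eq_def t]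
    by_cases hs : 1 < s.card
    · have ht : 1 < t.card := h ▸ hs
      rw [dif_pos hs, dif_pos ht]
      have : Nonempty s := (Finset.card_pos.mp (Nat.zero_lt_of_lt hs)).to_subtype
      have : Nonempty t := (Finset.card_pos.mp (Nat.zero_lt_of_lt ht)).to_subtype
      let e : s ≃o t := (s.orderIsoOfFin h).symm.trans (t.orderIsoOfFin rfl)
      rw [PMF.uniformOfFintype_bind_equiv e.toEquiv]
      congr 1
      funext p
      have key : ∀ (P : s → s → Prop) (Q : t → t → Prop) [∀ x, Decidable (P x p)]
          [∀ x, Decidable (Q x (e p))], (∀ x, P x p ↔ Q (e x) (e p)) →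
          (Finset.univ.filter fun x => P x p).card = (Finset.univ.filter fun x => Q x (e p)).card := by
        intro P Q _ _ hPQ
        exact Finset.card_equiv e.toEquiv fun i => by simpa using hPQ i
      have h1 : (s.filter fun x => x < (p : α)).card
          = (t.filter fun x => x < (e p : β)).card := by
        rw [card_filter_eq_card_filter_coe s, card_filter_eq_card_filter_coe t]
        exact key (fun x y => (x : α) < y) (fun x y => (x : β) < y) fun x => by simp
      have h2 : (s.filter fun x => (p : α) < x).card
          = (t.filter fun x => (e p : β) < x).card := by
        rw [card_filter_eq_card_filter_coe s, card_filter_eq_card_filter_coe t]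
        exact key (fun x y => (y : α) < x) (fun x y => (y : β) < x) fun x => by simp
      have l1 := Finset.card_lt_card
        (Finset.filter_ssubset.mpr ⟨p, p.2, lt_irrefl _⟩ : (s.filter fun x => x < (p : α)) ⊂ s)
      have l2 := Finset.card_lt_card
        (Finset.filter_ssubset.mpr ⟨p, p.2, lt_irrefl _⟩ : (s.filter fun x => (p : α) < x) ⊂ s)
      rw [ih _ l1 _ _ h1 rfl, ih _ l2 _ _ h2 rfl, h]
      rfl
    · rw [dif_neg hs, dif_neg (h ▸ hs)]

/-- The law of the number of comparisons on `n` keys. -/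
noncomputable def quicksortLaw (n : ℕ) : PMF ℕ := quicksortComparisons (Finset.range n)

theorem quicksortComparisons_eq_law {α : Type*} [LinearOrder α] (s : Finset α) :
    quicksortComparisons s = quicksortLaw s.card :=
  quicksortComparisons_eq_of_card_eq _ _ (by simp)

theorem finite_support_quicksortComparisons {α : Type*} [LinearOrder α] (s : Finset α) :
    (quicksortComparisons s).support.Finite := by
  induction hn : s.card using Nat.strong_induction_on generalizing s with
  | _ n ih =>
    subst hn
    rw [quicksortComparisons]
    split_ifs with hs
    · have : Nonempty s := (Finset.card_pos.mp (Nat.zero_lt_of_lt hs)).to_subtype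
      have h1 : ∀ p : s, (quicksortComparisons (s.filter fun x => x < (p : α))).support.Finite :=
        fun p => ih (s.filter fun x => x < (p : α)).card
          (Finset.card_lt_card (Finset.filter_ssubset.mpr ⟨p, p.2, lt_irrefl _⟩)) _ rfl
      have h2 : ∀ p : s, (quicksortComparisons (s.filter fun x => (p : α) < x)).support.Finite :=
        fun p => ih (s.filter fun x => (p : α) < x).card
          (Finset.card_lt_card (Finset.filter_ssubset.mpr ⟨p, p.2, lt_irrefl _⟩)) _ rfl
      rw [PMF.support_bind]
      refine Set.Finite.biUnion (Set.toFinite _) fun p _ => ?_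
      rw [PMF.support_bind]
      refine Set.Finite.biUnion (h1 p) fun a _ => ?_
      rw [PMF.support_bind]
      refine Set.Finite.biUnion (h2 p) fun b _ => ?_
      rw [PMF.support_pure]
      exact Set.finite_singleton _
    · simp

theorem finite_support_quicksortLaw (n : ℕ) : (quicksortLaw n).support.Finite :=
  finite_support_quicksortComparisons _

theorem quicksortLaw_of_le_one {n : ℕ} (hn : n ≤ 1) : quicksortLaw n = PMF.pure 0 := by
  rw [quicksortLaw, quicksortComparisons, dif_neg (by simpa using hn)]

theorem integral_quicksortLaw {E : Type*} [NormedAddCommGroup E] [NormedSpace ℝ E]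
    [CompleteSpace E] {n : ℕ} (hn : 1 ≤ n) (f : ℕ → E) :
    ∫ x, f x ∂(quicksortLaw n).toMeasure = (n : ℝ)⁻¹ • ∑ i ∈ Finset.range n,
      ∫ a, ∫ b, f (a + b + (n - 1)) ∂(quicksortLaw (n - 1 - i)).toMeasure
        ∂(quicksortLaw i).toMeasure := by
  -- For one key the definition takes its trivial branch, but the formula persists because the cost
  -- n - 1 is then 0.
  rcases hn.eq_or_lt with rfl | hn
  · simp [quicksortLaw_of_le_one, PMF.integral_pure]
  have hc : 1 < (Finset.range n).card := by simpa using hn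
  have : Nonempty (Finset.range n) := (Finset.card_pos.mp (Nat.zero_lt_of_lt hc)).to_subtype
  have key : quicksortLaw n = (PMF.uniformOfFintype (Finset.range n)).bind fun p =>
      (quicksortLaw p).bind fun a => (quicksortLaw (n - 1 - p)).bind fun b =>
        PMF.pure (a + b + (n - 1)) := by
    rw [quicksortLaw, quicksortComparisons, dif_pos hc]
    congr 1
    funext p
    have hp : (p : ℕ) < n := Finset.mem_range.1 p.2
    have h1 : ((Finset.range n).filter fun x => x < (p : ℕ)).card = p := by
      have : ((Finset.range n).filter fun x => x < (p : ℕ)) = Finset.range p := by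
        ext x; simp; omega
      simp [this]
    have h2 : ((Finset.range n).filter fun x => (p : ℕ) < x).card = n - 1 - p := by
      have : ((Finset.range n).filter fun x => (p : ℕ) < x) = Finset.Ioo (p : ℕ) n := by
        ext x; simp; omega
      rw [this, Nat.card_Ioo]; omega
    rw [quicksortComparisons_eq_law, quicksortComparisons_eq_law, h1, h2, Finset.card_range]
  rw [key, PMF.integral_bind (Set.toFinite _), PMF.integral_uniformOfFintype]
  · congr 1
    · simp
    rw [← Finset.sum_coe_sort (Finset.range n)]
    refine Finset.sum_congr rfl fun p _ => ?_
    rw [PMF.integral_bind (finite_support_quicksortLaw _)]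
    · congr 1
      funext a
      rw [PMF.integral_bind (finite_support_quicksortLaw _) (by simp)]
      simp [PMF.integral_pure]
    · intro a
      rw [PMF.support_bind]
      exact Set.Finite.biUnion (finite_support_quicksortLaw _) (by simp)
  · intro p
    simp only [PMF.support_bind, PMF.support_pure]
    exact Set.Finite.biUnion (finite_support_quicksortLaw _) fun a _ =>
      Set.Finite.biUnion (finite_support_quicksortLaw _) (by simp)

/-! ### Means and tolls. -/

/-- The mean number of comparisons on `n` keys. -/
noncomputable def quicksortExpectation (n : ℕ) : ℝ := ∫ x : ℕ, (x : ℝ) ∂(quicksortLaw n).toMeasure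

theorem integrable_quicksortLaw {E : Type*} [NormedAddCommGroup E] (n : ℕ) (f : ℕ → E) :
    Integrable f (quicksortLaw n).toMeasure :=
  PMF.integrable_of_finite_support (finite_support_quicksortLaw n) f

/-- The toll of a run on `n` keys whose pivot has rank `i`, centered by the means. -/
noncomputable def quicksortToll (n i : ℕ) : ℝ :=
  n - 1 + quicksortExpectation i + quicksortExpectation (n - 1 - i) - quicksortExpectation n

theorem quicksortExpectation_rec {n : ℕ} (hn : 1 ≤ n) :
    quicksortExpectation n = (n : ℝ)⁻¹ * ∑ i ∈ Finset.range n,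
      (quicksortExpectation i + quicksortExpectation (n - 1 - i) + (n - 1)) := by
  conv_lhs => rw [quicksortExpectation, integral_quicksortLaw hn]
  rw [smul_eq_mul]
  congr 1
  refine Finset.sum_congr rfl fun i _ => ?_
  push_cast [Nat.cast_sub hn]
  have h1 : ∀ a : ℕ, ∫ b : ℕ, ((a : ℝ) + b + (n - 1)) ∂(quicksortLaw (n - 1 - i)).toMeasure
      = a + (quicksortExpectation (n - 1 - i) + (n - 1)) := by
    intro a
    simp_rw [add_assoc]
    rw [integral_add (integrable_quicksortLaw _ _) (integrable_quicksortLaw _ _),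
      integral_add (integrable_quicksortLaw _ _) (integrable_quicksortLaw _ _)]
    simp [quicksortExpectation]
  simp_rw [h1]
  rw [integral_add (integrable_quicksortLaw _ _) (integrable_quicksortLaw _ _)]
  simp [quicksortExpectation, add_assoc]

theorem sum_quicksortToll {n : ℕ} (hn : 1 ≤ n) :
    ∑ i ∈ Finset.range n, quicksortToll n i = 0 := by
  have h := quicksortExpectation_rec hn
  have hn' : (n : ℝ) ≠ 0 := by positivity
  have h1 : ∑ i ∈ Finset.range n, quicksortToll n i = ∑ i ∈ Finset.range n,
      (quicksortExpectation i + quicksortExpectation (n - 1 - i) + (n - 1))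
      - n * quicksortExpectation n := by
    have h2 : n * quicksortExpectation n = ∑ _i ∈ Finset.range n, quicksortExpectation n := by simp
    rw [h2, ← Finset.sum_sub_distrib]
    refine Finset.sum_congr rfl fun i _ => ?_
    rw [quicksortToll]
    ring
  rw [h1, sub_eq_zero, h, ← mul_assoc, mul_inv_cancel₀ hn', one_mul]

theorem sum_range_harmonic_mul (n : ℕ) :
    ∑ j ∈ Finset.range n, (2 * ((j : ℝ) + 1) * harmonic j - 4 * j)
      = n * (n + 1) * harmonic n - 2 * n ^ 2 - n * (n - 1) / 2 := by
  induction n with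
  | zero => simp
  | succ n ih =>
    rw [Finset.sum_range_succ, ih, harmonic_succ]
    push_cast
    field_simp
    ring

theorem quicksortExpectation_eq (n : ℕ) :
    quicksortExpectation n = 2 * ((n : ℝ) + 1) * harmonic n - 4 * n := by
  induction n using Nat.strong_induction_on with
  | _ n ih =>
    rcases Nat.eq_zero_or_pos n with rfl | hn
    · simp [quicksortExpectation, quicksortLaw_of_le_one, PMF.integral_pure]
    have hn' : (n : ℝ) ≠ 0 := by positivity
    rw [quicksortExpectation_rec hn, Finset.sum_add_distrib, Finset.sum_add_distrib,
      Finset.sum_range_reflect (fun i => quicksortExpectation i) n,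
      Finset.sum_congr rfl fun i hi => ih i (Finset.mem_range.1 hi), sum_range_harmonic_mul]
    simp
    field_simp
    ring

/-- The limit of the normalized tolls. -/
noncomputable def tollLimit (u : ℝ) : ℝ :=
  1 + 2 * (u * Real.log u) + 2 * ((1 - u) * Real.log (1 - u))

@[fun_prop]
theorem continuous_tollLimit : Continuous tollLimit := by
  unfold tollLimit
  have h : Continuous fun u : ℝ => u * Real.log u := Real.continuous_mul_log
  exact (continuous_const.add (continuous_const.mul h)).add
    (continuous_const.mul (h.comp (continuous_const.sub continuous_id)))

theorem abs_mul_log_le_one {u : ℝ} (h0 : 0 ≤ u) (h1 : u ≤ 1) : |u * Real.log u| ≤ 1 := by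
  rcases h0.eq_or_lt with rfl | h0
  · simp
  · rw [mul_comm]
    exact (Real.abs_log_mul_self_lt u h0 h1).le

theorem abs_tollLimit_le {u : ℝ} (h0 : 0 ≤ u) (h1 : u ≤ 1) : |tollLimit u - 1| ≤ 4 := by
  have h2 := abs_le.1 (abs_mul_log_le_one h0 h1)
  have h3 := abs_le.1 (abs_mul_log_le_one (sub_nonneg.2 h1) (sub_le_self 1 h0))
  rw [tollLimit, abs_le]
  constructor <;> linarith

theorem integral_tollLimit : ∫ u in (0 : ℝ)..1, tollLimit u = 0 := by
  have hc : Continuous fun u : ℝ => u * Real.log u := Real.continuous_mul_log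
  have h : ∫ u in (0 : ℝ)..1, u * Real.log u = -1 / 4 := by
    rw [intervalIntegral.integral_eq_sub_of_hasDerivAt_of_le
      (f := fun u => (1 / 2) * (u * (u * Real.log u)) - u ^ 2 / 4) zero_le_one]
    · norm_num
    · exact (by fun_prop : Continuous _).continuousOn
    · intro x hx
      have hx0 : x ≠ 0 := hx.1.ne'
      have h1 := ((hasDerivAt_id x).mul ((hasDerivAt_id x).mul (Real.hasDerivAt_log hx0))).const_mul
        (1 / 2 : ℝ)
      have h2 := ((hasDerivAt_id x).pow 2).div_const 4
      convert! h1.sub h2 using 1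
      simp
      field_simp
      ring
    · exact hc.intervalIntegrable _ _
  have h' : ∫ u in (0 : ℝ)..1, (1 - u) * Real.log (1 - u) = -1 / 4 := by
    rw [intervalIntegral.integral_comp_sub_left (fun u => u * Real.log u)]
    simpa using h
  have hc' : Continuous fun u : ℝ => (1 - u) * Real.log (1 - u) :=
    hc.comp (continuous_const.sub continuous_id)
  simp only [tollLimit]
  rw [intervalIntegral.integral_add, intervalIntegral.integral_add,
    intervalIntegral.integral_const_mul, intervalIntegral.integral_const_mul, h, h']
  · norm_num
  all_goals exact (by fun_prop : Continuous _).intervalIntegrable _ _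

/-- Euler's constant lies between H_j - log(j+1) and H_{j+1} - log(j+1), which differ by 1/(j+1). -/
theorem abs_harmonic_remainder_le (j : ℕ) :
    |((j : ℝ) + 1) * (harmonic j - Real.log (j + 1) - Real.eulerMascheroniConstant)| ≤ 1 := by
  have h1 := Real.eulerMascheroniSeq_lt_eulerMascheroniConstant j
  have h2 := Real.eulerMascheroniConstant_lt_eulerMascheroniSeq' (j + 1)
  simp only [Real.eulerMascheroniSeq, Real.eulerMascheroniSeq', harmonic_succ, Nat.succ_ne_zero,
    if_false] at h1 h2
  push_cast at h2
  have hj : (0 : ℝ) < j + 1 := by positivity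
  rw [abs_mul, abs_of_pos hj, abs_of_nonpos (by linarith)]
  have : -(harmonic j - Real.log (j + 1) - Real.eulerMascheroniConstant) ≤ ((j : ℝ) + 1)⁻¹ := by
    linarith
  calc _ ≤ ((j : ℝ) + 1) * ((j : ℝ) + 1)⁻¹ := by gcongr
    _ = 1 := mul_inv_cancel₀ hj.ne'

/-- Sampling at (i+1)/(n+1) is natural: with k = n-1-i one has (i+1) + (k+1) = n+1, so the
logarithms assemble exactly into `tollLimit` and the multiples of Euler's constant cancel. The
constant is 13 = 3 + 4 + 3·2: a remainder 3, the bound 4 on `tollLimit` - 1, and three harmonic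
remainders. -/
theorem abs_toll_div_sub_tollLimit_le {n i : ℕ} (hi : i < n) :
    |quicksortToll n i / n - tollLimit ((i + 1) / (n + 1))| ≤ 13 / n := by
  obtain ⟨k, rfl⟩ : ∃ k, n = i + k + 1 := ⟨n - i - 1, by omega⟩
  have hk : i + k + 1 - 1 - i = k := by omega
  have ei := abs_harmonic_remainder_le i
  have ek := abs_harmonic_remainder_le k
  have en := abs_harmonic_remainder_le (i + k + 1)
  have hC := abs_tollLimit_le (u := ((i : ℝ) + 1) / ((i + k + 1 : ℕ) + 1)) (by positivity) (by
    rw [div_le_one (by positivity)]; push_cast; linarith [(Nat.cast_nonneg k : (0 : ℝ) ≤ k)])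
  rw [quicksortToll, hk, quicksortExpectation_eq, quicksortExpectation_eq, quicksortExpectation_eq]
  set Hi : ℝ := ((harmonic i : ℚ) : ℝ)
  set Hk : ℝ := ((harmonic k : ℚ) : ℝ)
  set Hn : ℝ := ((harmonic (i + k + 1) : ℚ) : ℝ)
  set N : ℝ := ((i + k + 1 : ℕ) : ℝ) with hN
  have hNe : N = i + k + 1 := by simp [hN]
  have hi0 : (0 : ℝ) ≤ i := Nat.cast_nonneg i
  have hk0 : (0 : ℝ) ≤ k := Nat.cast_nonneg k
  have hN0 : 0 < N := by rw [hNe]; positivity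
  have hu : 1 - ((i : ℝ) + 1) / (N + 1) = (k + 1) / (N + 1) := by
    rw [hNe]; field_simp; ring
  have hL : (N + 1) * (tollLimit (((i : ℝ) + 1) / (N + 1)) - 1)
      = 2 * ((i + 1) * Real.log (i + 1) + (k + 1) * Real.log (k + 1)
        - (N + 1) * Real.log (N + 1)) := by
    rw [tollLimit, hu, Real.log_div (by positivity) (by positivity),
      Real.log_div (by positivity) (by positivity), hNe]
    field_simp
    ring
  set c := tollLimit (((i : ℝ) + 1) / (N + 1))
  have key : (N - 1 + (2 * ((i : ℝ) + 1) * Hi - 4 * i) + (2 * ((k : ℝ) + 1) * Hk - 4 * k)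
      - (2 * (N + 1) * Hn - 4 * N)) / N - c
      = (3 + (c - 1) + 2 * (((i : ℝ) + 1) * (Hi - Real.log (i + 1) - Real.eulerMascheroniConstant))
        + 2 * (((k : ℝ) + 1) * (Hk - Real.log (k + 1) - Real.eulerMascheroniConstant))
        - 2 * ((N + 1) * (Hn - Real.log (N + 1) - Real.eulerMascheroniConstant))) / N := by
    rw [eq_div_iff hN0.ne', sub_mul, div_mul_cancel₀ _ hN0.ne']
    rw [hNe] at hL ⊢
    linear_combination (-1 : ℝ) * hL
  rw [key, abs_div, abs_of_pos hN0]
  gcongr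
  rw [abs_le] at *
  constructor <;> linarith

theorem abs_toll_div_le {n i : ℕ} (hi : i < n) : |quicksortToll n i / n| ≤ 18 := by
  have h1 := abs_toll_div_sub_tollLimit_le hi
  have hC := abs_tollLimit_le (u := ((i : ℝ) + 1) / (n + 1)) (by positivity) (by
    rw [div_le_one (by positivity)]
    have : (i : ℝ) ≤ n := by exact_mod_cast hi.le
    linarith)
  have h2 : (13 : ℝ) / n ≤ 13 := by
    have : (1 : ℝ) ≤ n := by exact_mod_cast Nat.one_le_of_lt hi
    exact div_le_self (by norm_num) this
  rw [abs_le] at *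
  constructor <;> linarith

/-! ### Uniform exponential moments. -/

/-- The moment generating function of the centered number of comparisons on `n` keys. -/
noncomputable def quicksortTransform (n : ℕ) (s : ℂ) : ℂ :=
  ∫ x : ℕ, Complex.exp (s * (x - quicksortExpectation n)) ∂(quicksortLaw n).toMeasure

theorem quicksortTransform_zero_left (s : ℂ) : quicksortTransform 0 s = 1 := by
  simp [quicksortTransform, quicksortLaw_of_le_one, PMF.integral_pure, quicksortExpectation_eq]

theorem quicksortTransform_rec {n : ℕ} (hn : 1 ≤ n) (s : ℂ) :
    quicksortTransform n s = (n : ℂ)⁻¹ * ∑ i ∈ Finset.range n,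
      quicksortTransform i s * quicksortTransform (n - 1 - i) s
        * Complex.exp (s * quicksortToll n i) := by
  conv_lhs => rw [quicksortTransform, integral_quicksortLaw hn]
  rw [Complex.real_smul]
  push_cast
  congr 1
  refine Finset.sum_congr rfl fun i _ => ?_
  push_cast [Nat.cast_sub hn]
  have h1 : ∀ a b : ℕ, Complex.exp (s * ((a : ℂ) + b + (n - 1) - quicksortExpectation n))
      = Complex.exp (s * (a - quicksortExpectation i))
        * (Complex.exp (s * (b - quicksortExpectation (n - 1 - i)))
        * Complex.exp (s * quicksortToll n i)) := by
    intro a b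
    rw [← Complex.exp_add, ← Complex.exp_add, quicksortToll]
    push_cast
    ring_nf
  simp_rw [h1, integral_const_mul, integral_mul_const]
  rw [quicksortTransform, quicksortTransform, mul_assoc]

/-- The real moment generating function of the centered number of comparisons on `n` keys. -/
noncomputable def quicksortMGF (n : ℕ) (s : ℝ) : ℝ :=
  ∫ x : ℕ, Real.exp (s * (x - quicksortExpectation n)) ∂(quicksortLaw n).toMeasure

theorem ofReal_quicksortMGF (n : ℕ) (s : ℝ) : (quicksortMGF n s : ℂ) = quicksortTransform n s := by
  rw [quicksortMGF, quicksortTransform, ← integral_complex_ofReal]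
  push_cast
  rfl

theorem quicksortMGF_nonneg (n : ℕ) (s : ℝ) : 0 ≤ quicksortMGF n s :=
  integral_nonneg fun _ => (Real.exp_pos _).le

theorem quicksortMGF_rec {n : ℕ} (hn : 1 ≤ n) (s : ℝ) :
    quicksortMGF n s = (n : ℝ)⁻¹ * ∑ i ∈ Finset.range n,
      quicksortMGF i s * quicksortMGF (n - 1 - i) s * Real.exp (s * quicksortToll n i) := by
  have h := quicksortTransform_rec hn s
  simp_rw [← ofReal_quicksortMGF] at h
  rw [← Complex.ofReal_inj, h]
  push_cast
  rfl

theorem sum_range_sq_le (n : ℕ) : ∑ i ∈ Finset.range n, (i : ℝ) ^ 2 ≤ n ^ 3 / 3 := by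
  induction n with
  | zero => simp
  | succ n ih =>
    rw [Finset.sum_range_succ]
    push_cast
    nlinarith [(Nat.cast_nonneg n : (0 : ℝ) ≤ n)]

/-- Induction with a Gaussian bound. The first-order terms cancel because the tolls sum to zero, and
the second-order terms are absorbed by the defect `V i` = 1 - (i/n)² - ((n-1-i)/n)², whose average
is at least 1/3. The constants are 3888 = 12·18² and 216 = 3888/18, where 18 bounds the normalized
tolls. -/
theorem quicksortMGF_le (n : ℕ) (s : ℝ) (hs : |s| * n ≤ 1 / 216) :
    quicksortMGF n s ≤ Real.exp (3888 * (s * n) ^ 2) := by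
  induction n using Nat.strong_induction_on with
  | _ n ih =>
    rcases Nat.eq_zero_or_pos n with rfl | hn
    · simp [quicksortMGF, quicksortLaw_of_le_one, PMF.integral_pure, quicksortExpectation_eq]
    have hn0 : (0 : ℝ) < n := by positivity
    set l : ℝ := s * n with hl
    have hl1 : |l| ≤ 1 / 216 := by rwa [hl, abs_mul, Nat.abs_cast]
    have hl2 : l ^ 2 ≤ (1 / 216) ^ 2 := sq_le_sq' (abs_le.1 hl1).1 (abs_le.1 hl1).2
    set V : ℕ → ℝ := fun i => 1 - ((i : ℝ) / n) ^ 2 - (((n - 1 - i : ℕ) : ℝ) / n) ^ 2 with hV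
    set c : ℕ → ℝ := fun i => quicksortToll n i / n with hc
    have hIH : ∀ m, m < n → quicksortMGF m s ≤ Real.exp (3888 * (s * m) ^ 2) := by
      intro m hm
      refine ih m hm (le_trans ?_ hs)
      gcongr
    have hterm : ∀ i ∈ Finset.range n,
        quicksortMGF i s * quicksortMGF (n - 1 - i) s * Real.exp (s * quicksortToll n i)
          ≤ Real.exp (3888 * l ^ 2) * Real.exp (l * c i - 3888 * l ^ 2 * V i) := by
      intro i hi
      have hi := Finset.mem_range.1 hi
      calc _ ≤ Real.exp (3888 * (s * i) ^ 2) * Real.exp (3888 * (s * (n - 1 - i : ℕ)) ^ 2)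
            * Real.exp (s * quicksortToll n i) := by
            gcongr
            · exact quicksortMGF_nonneg _ _
            · exact hIH i hi
            · exact hIH _ (by omega)
        _ = _ := by
            rw [← Real.exp_add, ← Real.exp_add, ← Real.exp_add, hl, hc, hV]
            congr 1
            field_simp
            ring
    -- This is exp w ≤ 1 + w + w² for |w| ≤ 1, followed by (a-b)² ≤ 2a² + 2b².
    have hw : ∀ i ∈ Finset.range n, Real.exp (l * c i - 3888 * l ^ 2 * V i)
        ≤ 1 + l * c i - 3888 * l ^ 2 * V i + (2 * 18 ^ 2 * l ^ 2 + 2 * 3888 ^ 2 * l ^ 4) := by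
      intro i hi
      have hi := Finset.mem_range.1 hi
      have hci : |c i| ≤ 18 := abs_toll_div_le hi
      have hij : ((n - 1 - i : ℕ) : ℝ) = n - 1 - i := by
        rw [Nat.cast_sub (by omega), Nat.cast_sub hn]; simp
      have hi1 : (i : ℝ) + 1 ≤ n := by exact_mod_cast hi
      have hi0 : (0 : ℝ) ≤ i := Nat.cast_nonneg i
      have hV1 : V i ≤ 1 := by
        simp only [hV]; nlinarith [sq_nonneg ((i : ℝ) / n), sq_nonneg (((n - 1 - i : ℕ) : ℝ) / n)]
      have hV0 : 0 ≤ V i := by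
        simp only [hV, hij]
        have h1 : 1 - ((i : ℝ) / n) ^ 2 - (((n : ℝ) - 1 - i) / n) ^ 2
            = (n ^ 2 - i ^ 2 - (n - 1 - i) ^ 2) / n ^ 2 := by field_simp
        rw [h1]
        apply div_nonneg _ (by positivity)
        nlinarith
      have hlc : |l * c i| ≤ 18 / 216 := by
        rw [abs_mul]
        calc |l| * |c i| ≤ 1 / 216 * 18 := by gcongr
          _ = _ := by norm_num
      have hlV : 0 ≤ l ^ 2 * V i := by positivity
      have hlV' : l ^ 2 * V i ≤ l ^ 2 := mul_le_of_le_one_right (by positivity) hV1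
      have hw1 : |l * c i - 3888 * l ^ 2 * V i| ≤ 1 := by
        rw [abs_le] at hlc ⊢
        constructor <;> nlinarith
      have h3 := (abs_le.1 (Real.abs_exp_sub_one_sub_id_le hw1)).2
      have h4 : (l * c i - 3888 * l ^ 2 * V i) ^ 2
          ≤ 2 * (l * c i) ^ 2 + 2 * (3888 * (l ^ 2 * V i)) ^ 2 := by
        nlinarith [sq_nonneg (l * c i + 3888 * l ^ 2 * V i)]
      have h5 : (l * c i) ^ 2 ≤ 18 ^ 2 * l ^ 2 := by
        rw [mul_pow, mul_comm]
        gcongr ?_ * _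
        exact sq_le_sq' (abs_le.1 hci).1 (abs_le.1 hci).2
      have h6 : (3888 * (l ^ 2 * V i)) ^ 2 ≤ 3888 ^ 2 * l ^ 4 := by
        have : (l ^ 2 * V i) ^ 2 ≤ (l ^ 2) ^ 2 := by gcongr
        nlinarith
      linarith
    have hsumc : ∑ i ∈ Finset.range n, c i = 0 := by
      rw [hc, ← Finset.sum_div, sum_quicksortToll hn, zero_div]
    have hsumV : (n : ℝ) / 3 ≤ ∑ i ∈ Finset.range n, V i := by
      have h1 : ∑ i ∈ Finset.range n, V i
          = n - 2 * ((∑ i ∈ Finset.range n, (i : ℝ) ^ 2) / n ^ 2) := by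
        simp only [hV, Finset.sum_sub_distrib]
        rw [Finset.sum_range_reflect (fun i => ((i : ℝ) / n) ^ 2) n]
        simp only [div_pow, ← Finset.sum_div]
        simp
        ring
      have h2 : (∑ i ∈ Finset.range n, (i : ℝ) ^ 2) / n ^ 2 ≤ n / 3 := by
        rw [div_le_iff₀ (by positivity)]
        exact (sum_range_sq_le n).trans_eq (by ring)
      rw [h1]
      linarith
    have hsum : ∑ i ∈ Finset.range n, Real.exp (l * c i - 3888 * l ^ 2 * V i) ≤ n := by
      refine (Finset.sum_le_sum hw).trans ?_
      rw [Finset.sum_add_distrib, Finset.sum_sub_distrib, Finset.sum_add_distrib,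
        ← Finset.mul_sum, ← Finset.mul_sum, hsumc]
      simp only [Finset.sum_const, Finset.card_range, nsmul_eq_mul, mul_one, mul_zero, add_zero]
      have h1 : 3888 * l ^ 2 * ((n : ℝ) / 3) ≤ 3888 * l ^ 2 * ∑ i ∈ Finset.range n, V i := by
        gcongr
      -- The choice of constants makes this tight: with |l| ≤ 1/216 each of the two left-hand terms
      -- is at most 648 l², and the right-hand side is 1296 l².
      have h2 : (2 * 18 ^ 2 * l ^ 2 + 2 * 3888 ^ 2 * l ^ 4) ≤ 3888 * l ^ 2 / 3 := by
        have : l ^ 2 * l ^ 2 ≤ l ^ 2 * (1 / 216) ^ 2 := by gcongr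
        nlinarith
      have h3 : (n : ℝ) * (2 * 18 ^ 2 * l ^ 2 + 2 * 3888 ^ 2 * l ^ 4) ≤ n * (3888 * l ^ 2 / 3) := by
        gcongr
      linarith
    rw [quicksortMGF_rec hn]
    calc _ ≤ (n : ℝ)⁻¹ * ∑ i ∈ Finset.range n,
          Real.exp (3888 * l ^ 2) * Real.exp (l * c i - 3888 * l ^ 2 * V i) := by
          exact mul_le_mul_of_nonneg_left (Finset.sum_le_sum hterm) (by positivity)
      _ ≤ (n : ℝ)⁻¹ * (Real.exp (3888 * l ^ 2) * n) := by
          rw [← Finset.mul_sum]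
          gcongr
      _ = _ := by field_simp

/-- The standardized number of comparisons on `n` keys. -/
noncomputable def quicksortY (n x : ℕ) : ℝ := (x - quicksortExpectation n) / n

/-- Since exp|y| ≤ exp y + exp(-y), two evaluations of the moment generating function suffice. At n
= 0 division by zero makes everything trivial. -/
theorem exists_exp_moment_bound : ∃ l : ℝ, 0 < l ∧ ∃ B : ℝ, ∀ n : ℕ,
    ∫ x : ℕ, Real.exp (l * |quicksortY n x|) ∂(quicksortLaw n).toMeasure ≤ B := by
  refine ⟨1 / 216, by norm_num, 2 * Real.exp (3888 * (1 / 216) ^ 2), fun n => ?_⟩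
  have hb : ∀ s : ℝ, |s| = 1 / 216 / n → quicksortMGF n s ≤ Real.exp (3888 * (1 / 216) ^ 2) := by
    intro s hs
    have h1 : |s| * n ≤ 1 / 216 := by
      rw [hs]
      rcases eq_or_ne (n : ℝ) 0 with h0 | h0
      · simp [h0]
      · rw [div_mul_cancel₀ _ h0]
    refine (quicksortMGF_le n s h1).trans ?_
    gcongr 1
    gcongr 1
    rw [← sq_abs (s * n), abs_mul, Nat.abs_cast]
    gcongr
  calc _ ≤ ∫ x : ℕ, (Real.exp (1 / 216 / n * (x - quicksortExpectation n))
        + Real.exp (-(1 / 216 / n) * (x - quicksortExpectation n))) ∂(quicksortLaw n).toMeasure := by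
        refine integral_mono (integrable_quicksortLaw _ _) (integrable_quicksortLaw _ _) fun x => ?_
        simp only [quicksortY]
        rw [abs_div, Nat.abs_cast]
        rcases abs_cases ((x : ℝ) - quicksortExpectation n) with ⟨h, _⟩ | ⟨h, _⟩ <;> rw [h]
        · rw [show (1 / 216 : ℝ) * ((x - quicksortExpectation n) / n)
            = 1 / 216 / n * (x - quicksortExpectation n) by ring]
          exact le_add_of_nonneg_right (Real.exp_pos _).le
        · rw [show (1 / 216 : ℝ) * (-(x - quicksortExpectation n) / n)
            = -(1 / 216 / n) * (x - quicksortExpectation n) by ring]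
          exact le_add_of_nonneg_left (Real.exp_pos _).le
    _ = quicksortMGF n (1 / 216 / n) + quicksortMGF n (-(1 / 216 / n)) :=
        integral_add (integrable_quicksortLaw _ _) (integrable_quicksortLaw _ _)
    _ ≤ _ := by
        rw [two_mul]
        gcongr
        · exact hb _ (abs_of_nonneg (by positivity))
        · exact hb _ (by rw [abs_neg]; exact abs_of_nonneg (by positivity))

/-! ### Characteristic functions of the standardized counts. -/

theorem norm_exp_mul_I_sub_one_sub_le (x : ℝ) :
    ‖Complex.exp (x * Complex.I) - 1 - x * Complex.I‖ ≤ 3 * x ^ 2 := by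
  have hx : ‖(x : ℂ) * Complex.I‖ = |x| := by simp
  rcases le_total |x| 1 with h | h
  · refine (Complex.norm_exp_sub_one_sub_id_le (by rwa [hx])).trans ?_
    rw [hx, sq_abs]
    nlinarith [sq_nonneg x]
  · have h1 : ‖Complex.exp (x * Complex.I)‖ = 1 := Complex.norm_exp_ofReal_mul_I x
    calc _ ≤ ‖Complex.exp (x * Complex.I)‖ + ‖(1 : ℂ)‖ + ‖(x : ℂ) * Complex.I‖ :=
          (norm_sub_le _ _).trans (by gcongr; exact norm_sub_le _ _)
      _ ≤ _ := by
          rw [h1, hx, norm_one, ← sq_abs]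
          nlinarith

/-- The characteristic function of the standardized number of comparisons on `n` keys. -/
noncomputable def quicksortChar (n : ℕ) (t : ℝ) : ℂ :=
  ∫ x : ℕ, Complex.exp (t * quicksortY n x * Complex.I) ∂(quicksortLaw n).toMeasure

theorem quicksortChar_eq_transform (n : ℕ) (t : ℝ) :
    quicksortChar n t = quicksortTransform n (t / n * Complex.I) := by
  rw [quicksortChar, quicksortTransform]
  congr 1
  funext x
  rw [quicksortY]
  push_cast
  ring_nf

theorem integral_quicksortY (n : ℕ) : ∫ x : ℕ, quicksortY n x ∂(quicksortLaw n).toMeasure = 0 := by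
  simp only [quicksortY]
  rw [integral_div, integral_sub (integrable_quicksortLaw _ _) (integrable_quicksortLaw _ _)]
  simp [quicksortExpectation]

/-- The mean is zero and the second moments are uniformly bounded. The resulting quadratic estimate
places all these functions within finite distance of the fixed point in the t²-weighted metric. -/
theorem exists_norm_quicksortChar_sub_one_le :
    ∃ K : ℝ, 0 ≤ K ∧ ∀ n t, ‖quicksortChar n t - 1‖ ≤ K * t ^ 2 := by
  obtain ⟨l, hl, B, hB⟩ := exists_exp_moment_bound
  have hB0 : 0 ≤ B := (integral_nonneg fun _ => (Real.exp_pos _).le).trans (hB 0)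
  refine ⟨6 / l ^ 2 * B, by positivity, fun n t => ?_⟩
  have h1 : quicksortChar n t - 1 = ∫ x : ℕ, (Complex.exp ((t * quicksortY n x : ℝ) * Complex.I)
      - 1 - (t * quicksortY n x : ℝ) * Complex.I) ∂(quicksortLaw n).toMeasure := by
    rw [integral_sub (integrable_quicksortLaw _ _) (integrable_quicksortLaw _ _),
      integral_sub (integrable_quicksortLaw _ _) (integrable_quicksortLaw _ _), integral_mul_const,
      integral_complex_ofReal, integral_const_mul, integral_quicksortY]
    simp [quicksortChar]
  rw [h1]
  refine (norm_integral_le_integral_norm _).trans ?_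
  calc _ ≤ ∫ x : ℕ, 6 / l ^ 2 * t ^ 2 * Real.exp (l * |quicksortY n x|)
        ∂(quicksortLaw n).toMeasure := by
        refine integral_mono (integrable_quicksortLaw _ _) (integrable_quicksortLaw _ _) fun x => ?_
        refine (norm_exp_mul_I_sub_one_sub_le _).trans ?_
        have h2 := Real.quadratic_le_exp_of_nonneg (x := l * |quicksortY n x|) (by positivity)
        have h3 : 0 ≤ l * |quicksortY n x| := by positivity
        have h4 : l ^ 2 * quicksortY n x ^ 2 ≤ 2 * Real.exp (l * |quicksortY n x|) := by
          rw [← sq_abs (quicksortY n x), ← mul_pow]; linarith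
        calc 3 * (t * quicksortY n x) ^ 2
            = 3 * t ^ 2 / l ^ 2 * (l ^ 2 * quicksortY n x ^ 2) := by field_simp
          _ ≤ 3 * t ^ 2 / l ^ 2 * (2 * Real.exp (l * |quicksortY n x|)) := by gcongr
          _ = _ := by ring
    _ ≤ 6 / l ^ 2 * t ^ 2 * B := by
        rw [integral_const_mul]
        gcongr
        exact hB n
    _ = _ := by ring

theorem norm_quicksortChar_le_one (n : ℕ) (t : ℝ) : ‖quicksortChar n t‖ ≤ 1 := by
  refine (norm_integral_le_of_norm_le_const (C := 1) (.of_forall fun x => ?_)).trans (by simp)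
  rw [← Complex.ofReal_mul, Complex.norm_exp_ofReal_mul_I]

theorem quicksortChar_rec {n : ℕ} (hn : 1 ≤ n) (t : ℝ) :
    quicksortChar n t = (n : ℂ)⁻¹ * ∑ i ∈ Finset.range n,
      quicksortChar i (i / n * t) * quicksortChar (n - 1 - i) ((n - 1 - i : ℕ) / n * t)
        * Complex.exp (t * (quicksortToll n i / n : ℝ) * Complex.I) := by
  have h : ∀ m : ℕ, quicksortChar m (m / n * t) = quicksortTransform m (t / n * Complex.I) := by
    intro m
    rcases Nat.eq_zero_or_pos m with rfl | hm
    · rw [quicksortChar_eq_transform, quicksortTransform_zero_left, quicksortTransform_zero_left]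
    rw [quicksortChar_eq_transform]
    congr 2
    push_cast
    have hm' : (m : ℂ) ≠ 0 := by exact_mod_cast hm.ne'
    have hn' : (n : ℂ) ≠ 0 := by exact_mod_cast (Nat.pos_of_ne_zero (by omega)).ne'
    field_simp
  rw [quicksortChar_eq_transform, quicksortTransform_rec hn]
  congr 1
  refine Finset.sum_congr rfl fun i _ => ?_
  rw [h, h]
  congr 2
  push_cast
  ring

/-! ### The limiting operator and its fixed point. -/

/-- The distributional recursion of the Quicksort limit, acting on characteristic functions. -/
noncomputable def quicksortOp (f : ℝ → ℂ) (t : ℝ) : ℂ :=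
  ∫ u in (0 : ℝ)..1, f (u * t) * f ((1 - u) * t) * Complex.exp (t * (tollLimit u : ℝ) * Complex.I)

theorem norm_exp_ofReal_mul_ofReal_mul_I (a b : ℝ) :
    ‖Complex.exp ((a : ℂ) * b * Complex.I)‖ = 1 := by
  rw [← Complex.ofReal_mul, Complex.norm_exp_ofReal_mul_I]

theorem continuous_quicksortOp_integrand {f : ℝ → ℂ} (hf : Continuous f) :
    Continuous fun p : ℝ × ℝ => f (p.2 * p.1) * f ((1 - p.2) * p.1)
      * Complex.exp (p.1 * (tollLimit p.2 : ℝ) * Complex.I) := by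
  fun_prop

theorem intervalIntegrable_quicksortOp_integrand {f : ℝ → ℂ} (hf : Continuous f) (t a b : ℝ) :
    IntervalIntegrable (fun u : ℝ => f (u * t) * f ((1 - u) * t)
      * Complex.exp (t * (tollLimit u : ℝ) * Complex.I)) volume a b :=
  (by fun_prop : Continuous _).intervalIntegrable _ _

theorem continuous_quicksortOp {f : ℝ → ℂ} (hf : Continuous f) : Continuous (quicksortOp f) := by
  unfold quicksortOp
  exact intervalIntegral.continuous_parametric_intervalIntegral_of_continuous'
    (continuous_quicksortOp_integrand hf) 0 1

theorem norm_quicksortOp_le_one {f : ℝ → ℂ} (hf : ∀ t, ‖f t‖ ≤ 1) (t : ℝ) :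
    ‖quicksortOp f t‖ ≤ 1 := by
  have h := intervalIntegral.norm_integral_le_of_norm_le_const (a := 0) (b := 1) (C := 1)
    (f := fun u : ℝ => f (u * t) * f ((1 - u) * t)
      * Complex.exp (t * (tollLimit u : ℝ) * Complex.I)) fun u _ => by
    rw [norm_mul, norm_mul, norm_exp_ofReal_mul_ofReal_mul_I, mul_one]
    exact mul_le_one₀ (hf _) (norm_nonneg _) (hf _)
  simpa [quicksortOp] using h

theorem norm_mul_mul_sub_mul_mul_le {a b c a' b' c' : ℂ} (hb : ‖b‖ ≤ 1) (hc : ‖c‖ ≤ 1)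
    (ha' : ‖a'‖ ≤ 1) (hb' : ‖b'‖ ≤ 1) :
    ‖a * b * c - a' * b' * c'‖ ≤ ‖a - a'‖ + ‖b - b'‖ + ‖c - c'‖ := by
  have h : a * b * c - a' * b' * c' = (a - a') * (b * c) + a' * (b - b') * c + a' * b' * (c - c') := by
    ring
  rw [h]
  refine norm_add₃_le.trans ?_
  simp only [norm_mul]
  gcongr
  · exact mul_le_of_le_one_right (norm_nonneg _) (mul_le_one₀ hb (norm_nonneg _) hc)
  · calc ‖a'‖ * ‖b - b'‖ * ‖c‖ ≤ 1 * ‖b - b'‖ * 1 := by gcongr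
      _ = _ := by ring
  · exact mul_le_of_le_one_left (norm_nonneg _) (mul_le_one₀ ha' (norm_nonneg _) hb')

/-- Both factors contribute, with weights u² and (1-u)², and ∫₀¹ (u² + (1-u)²) du = 2/3. -/
theorem norm_quicksortOp_sub_le {f h : ℝ → ℂ} (hf : Continuous f) (hh : Continuous h)
    (hf1 : ∀ t, ‖f t‖ ≤ 1) (hh1 : ∀ t, ‖h t‖ ≤ 1) {A : ℝ} (hA : ∀ t, ‖f t - h t‖ ≤ A * t ^ 2)
    (t : ℝ) : ‖quicksortOp f t - quicksortOp h t‖ ≤ 2 / 3 * A * t ^ 2 := by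
  rw [quicksortOp, quicksortOp, ← intervalIntegral.integral_sub
    (intervalIntegrable_quicksortOp_integrand hf _ _ _)
    (intervalIntegrable_quicksortOp_integrand hh _ _ _)]
  calc _ ≤ ∫ u in (0 : ℝ)..1, A * t ^ 2 * (u ^ 2 + (1 - u) ^ 2) := by
        refine intervalIntegral.norm_integral_le_of_norm_le zero_le_one (.of_forall fun u _ => ?_)
          ((by fun_prop : Continuous _).intervalIntegrable _ _)
        refine (norm_mul_mul_sub_mul_mul_le (hf1 _)
          (norm_exp_ofReal_mul_ofReal_mul_I _ _).le (hh1 _) (hh1 _)).trans ?_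
        rw [sub_self, norm_zero]
        calc _ ≤ A * (u * t) ^ 2 + A * ((1 - u) * t) ^ 2 + 0 := by gcongr <;> exact hA _
          _ = _ := by ring
    _ = _ := by
        have h1 : ∫ u in (0 : ℝ)..1, (1 - u) ^ 2 = 1 / 3 := by
          rw [intervalIntegral.integral_comp_sub_left (fun u => u ^ 2)]
          norm_num
        rw [intervalIntegral.integral_const_mul, intervalIntegral.integral_add, h1, integral_pow]
        · norm_num; ring
        all_goals exact (by fun_prop : Continuous _).intervalIntegrable _ _

/-- `tollLimit` has integral zero, which removes the linear term; 75 = 3·5², where 5 bounds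
|`tollLimit`| on [0, 1]. -/
theorem norm_quicksortOp_one_sub_one_le (t : ℝ) :
    ‖quicksortOp (fun _ => 1) t - 1‖ ≤ 75 * t ^ 2 := by
  have h0 : ∫ u in (0 : ℝ)..1, ((t * tollLimit u : ℝ) : ℂ) * Complex.I = 0 := by
    rw [intervalIntegral.integral_mul_const, intervalIntegral.integral_ofReal,
      intervalIntegral.integral_const_mul, integral_tollLimit]
    simp
  have h1 : quicksortOp (fun _ => 1) t - 1 = ∫ u in (0 : ℝ)..1,
      (Complex.exp ((t * tollLimit u : ℝ) * Complex.I) - 1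
        - (t * tollLimit u : ℝ) * Complex.I) := by
    rw [intervalIntegral.integral_sub, intervalIntegral.integral_sub, h0]
    · simp [quicksortOp]
    all_goals exact (by fun_prop : Continuous _).intervalIntegrable _ _
  rw [h1]
  have h2 := intervalIntegral.norm_integral_le_of_norm_le_const (a := 0) (b := 1) (C := 75 * t ^ 2)
    (f := fun u : ℝ => Complex.exp ((t * tollLimit u : ℝ) * Complex.I) - 1
        - (t * tollLimit u : ℝ) * Complex.I) fun u hu => by
    rw [Set.uIoc_of_le zero_le_one] at hu
    have h3 := abs_le.1 (abs_tollLimit_le hu.1.le hu.2)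
    have h4 : tollLimit u ^ 2 ≤ 25 := by nlinarith
    refine (norm_exp_mul_I_sub_one_sub_le _).trans ?_
    rw [mul_pow]
    nlinarith [sq_nonneg t]
  simpa using h2

theorem exists_quicksortOp_fixedPoint : ∃ g : ℝ → ℂ, Continuous g ∧ (∀ t, ‖g t‖ ≤ 1) ∧
    (∀ t, ‖g t - 1‖ ≤ 225 * t ^ 2) ∧ ∀ t, quicksortOp g t = g t := by
  set G : ℕ → ℝ → ℂ := fun k => quicksortOp^[k] fun _ => 1 with hG
  have hs : ∀ k, G (k + 1) = quicksortOp (G k) := fun k => Function.iterate_succ_apply' _ _ _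
  have hGc : ∀ k, Continuous (G k) := by
    intro k
    induction k with
    | zero => exact continuous_const
    | succ k ih => rw [hs]; exact continuous_quicksortOp ih
  have hG1 : ∀ k t, ‖G k t‖ ≤ 1 := by
    intro k
    induction k with
    | zero => intro t; simp [hG]
    | succ k ih => rw [hs]; exact norm_quicksortOp_le_one ih
  have hd : ∀ k t, ‖G (k + 1) t - G k t‖ ≤ 75 * (2 / 3) ^ k * t ^ 2 := by
    intro k
    induction k with
    | zero => intro t; simpa [hG] using norm_quicksortOp_one_sub_one_le t
    | succ k ih =>
      intro t
      rw [hs (k + 1), hs k]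
      rw [hs k] at ih
      refine (norm_quicksortOp_sub_le (continuous_quicksortOp (hGc k)) (hGc k) ?_ (hG1 k) ih
        t).trans_eq (by ring)
      rw [← hs]; exact hG1 _
  have hd' : ∀ t k, dist (G k t) (G (k + 1) t) ≤ 75 * t ^ 2 * (2 / 3) ^ k := by
    intro t k
    rw [dist_comm, dist_eq_norm]
    exact (hd k t).trans_eq (by ring)
  have hlim : ∀ t, ∃ y, Tendsto (fun k => G k t) atTop (𝓝 y) := fun t =>
    cauchySeq_tendsto_of_complete (cauchySeq_of_le_geometric _ _ (by norm_num) (hd' t))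
  choose g hg using hlim
  -- Geometric tail: 75/(1 - 2/3) = 225.
  have hGg : ∀ k t, ‖G k t - g t‖ ≤ 225 * (2 / 3) ^ k * t ^ 2 := by
    intro k t
    rw [← dist_eq_norm]
    exact (dist_le_of_le_geometric_of_tendsto _ _ (by norm_num) (hd' t) (hg t) k).trans_eq (by ring)
  have hg1 : ∀ t, ‖g t‖ ≤ 1 := fun t => le_of_tendsto (hg t).norm (.of_forall fun k => hG1 k t)
  have hpow : Tendsto (fun k : ℕ => (2 / 3 : ℝ) ^ k) atTop (𝓝 0) :=
    tendsto_pow_atTop_nhds_zero_of_lt_one (by norm_num) (by norm_num)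
  have hgc : Continuous g := by
    have hu : TendstoLocallyUniformly G g atTop := by
      rw [Metric.tendstoLocallyUniformly_iff]
      intro ε hε x
      refine ⟨Metric.ball x 1, Metric.ball_mem_nhds x one_pos, ?_⟩
      have h1 : Tendsto (fun k : ℕ => 225 * (2 / 3 : ℝ) ^ k * (|x| + 1) ^ 2) atTop (𝓝 0) := by
        simpa using (hpow.const_mul 225).mul_const ((|x| + 1) ^ 2)
      filter_upwards [h1.eventually (gt_mem_nhds hε)] with k hk y hy
      rw [dist_comm, dist_eq_norm]
      refine (hGg k y).trans_lt (lt_of_le_of_lt ?_ hk)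
      have h2 : |y| ≤ |x| + 1 := by
        have h3 : |y - x| < 1 := by simpa [Real.dist_eq] using hy
        have := abs_sub_abs_le_abs_sub y x
        linarith
      rw [← sq_abs y]
      gcongr
    exact hu.continuous (Frequently.of_forall hGc)
  refine ⟨g, hgc, hg1, fun t => ?_, fun t => ?_⟩
  · rw [norm_sub_rev]
    simpa [hG] using hGg 0 t
  · refine tendsto_nhds_unique (?_ : Tendsto (fun k => G (k + 1) t) atTop _)
      ((tendsto_add_atTop_iff_nat 1).2 (hg t))
    rw [tendsto_iff_norm_sub_tendsto_zero]
    refine squeeze_zero (fun _ => norm_nonneg _) (fun k => ?_)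
      (by simpa using hpow.mul_const (2 / 3 * 225 * t ^ 2) :
        Tendsto (fun k : ℕ => (2 / 3 : ℝ) ^ k * (2 / 3 * 225 * t ^ 2)) atTop (𝓝 0))
    rw [hs]
    exact (norm_quicksortOp_sub_le (hGc k) hgc (hG1 k) hg1 (hGg k) t).trans_eq (by ring)

/-! ### Convergence of the characteristic functions. -/

theorem norm_exp_mul_I_sub_exp_mul_I_le (t a b : ℝ) :
    ‖Complex.exp (t * a * Complex.I) - Complex.exp (t * b * Complex.I)‖ ≤ |t| * |a - b| := by
  have h : Complex.exp (t * a * Complex.I) - Complex.exp (t * b * Complex.I)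
      = Complex.exp (t * b * Complex.I) * (Complex.exp (Complex.I * (t * (a - b) : ℝ)) - 1) := by
    rw [mul_sub, ← Complex.exp_add]
    push_cast
    ring_nf
  rw [h, norm_mul, norm_exp_ofReal_mul_ofReal_mul_I, one_mul, ← abs_mul]
  exact Real.norm_exp_I_mul_ofReal_sub_one_le

theorem norm_sum_sub_integral_le {F : ℝ → ℂ} (hF : Continuous F) {n : ℕ} (hn : 1 ≤ n) (a : ℕ → ℂ)
    {ε : ℝ} (h : ∀ i < n, ∀ u : ℝ, (i : ℝ) / n ≤ u → u ≤ ((i : ℝ) + 1) / n → ‖a i - F u‖ ≤ ε) :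
    ‖(n : ℂ)⁻¹ * ∑ i ∈ Finset.range n, a i - ∫ u in (0 : ℝ)..1, F u‖ ≤ ε := by
  have hn0 : (0 : ℝ) < n := by exact_mod_cast hn
  have h1 : ∫ u in (0 : ℝ)..1, F u
      = ∑ i ∈ Finset.range n, ∫ u in ((i : ℝ) / n)..(((i + 1 : ℕ) : ℝ) / n), F u := by
    rw [intervalIntegral.sum_integral_adjacent_intervals (a := fun i : ℕ => (i : ℝ) / n)
      fun k _ => hF.intervalIntegrable _ _]
    simp [hn0.ne']
  have hlen : ∀ i : ℕ, ((i + 1 : ℕ) : ℝ) / n - (i : ℝ) / n = (n : ℝ)⁻¹ := by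
    intro i; push_cast; field_simp; ring
  have h2 : (n : ℂ)⁻¹ * ∑ i ∈ Finset.range n, a i
      = ∑ i ∈ Finset.range n, ∫ _ in ((i : ℝ) / n)..(((i + 1 : ℕ) : ℝ) / n), a i := by
    rw [Finset.mul_sum]
    refine Finset.sum_congr rfl fun i _ => ?_
    rw [intervalIntegral.integral_const, hlen]
    simp
  rw [h1, h2, ← Finset.sum_sub_distrib]
  calc _ ≤ ∑ i ∈ Finset.range n, ε * (n : ℝ)⁻¹ := by
        refine norm_sum_le_of_le _ fun i hi => ?_
        rw [← intervalIntegral.integral_sub (by simp) (hF.intervalIntegrable _ _)]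
        have hle : (i : ℝ) / n ≤ ((i + 1 : ℕ) : ℝ) / n := by
          have : 0 < (n : ℝ)⁻¹ := by positivity
          linarith [hlen i]
        refine (intervalIntegral.norm_integral_le_of_norm_le_const (C := ε) fun u hu => ?_).trans ?_
        · rw [Set.uIoc_of_le hle] at hu
          refine h i (Finset.mem_range.1 hi) u hu.1.le ?_
          simpa using hu.2
        · rw [hlen, abs_of_pos (by positivity)]
    _ = ε := by
        rw [Finset.sum_const, Finset.card_range, nsmul_eq_mul]
        field_simp

/-- Uniform continuity of g on [-T, T] and of `tollLimit` on [0, 1] makes each summand uniformly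
close to the integrand on its cell [i/n, (i+1)/n]. -/
theorem exists_riemann_sum_close {g : ℝ → ℂ} (hg : Continuous g) (hg1 : ∀ t, ‖g t‖ ≤ 1) (T : ℝ)
    {ε : ℝ} (hε : 0 < ε) : ∃ N : ℕ, ∀ n ≥ N, ∀ t, |t| ≤ T →
      ‖(n : ℂ)⁻¹ * ∑ i ∈ Finset.range n, g (i / n * t) * g ((n - 1 - i : ℕ) / n * t)
        * Complex.exp (t * (quicksortToll n i / n : ℝ) * Complex.I) - quicksortOp g t‖ ≤ ε := by
  rcases lt_or_ge T 0 with hT | hT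
  · exact ⟨0, fun n _ t ht => absurd (ht.trans_lt hT) (abs_nonneg t).not_gt⟩
  have huc : ∀ η > 0, ∃ δ > 0, ∀ x ∈ Set.Icc (-T) T, ∀ y ∈ Set.Icc (-T) T, |x - y| < δ →
      ‖g x - g y‖ < η := by
    have := (isCompact_Icc (a := -T) (b := T)).uniformContinuousOn_of_continuous hg.continuousOn
    rw [Metric.uniformContinuousOn_iff] at this
    simpa only [Real.dist_eq, dist_eq_norm (E := ℂ)] using this
  have hut : ∀ η > 0, ∃ δ > 0, ∀ x ∈ Set.Icc (0 : ℝ) 1, ∀ y ∈ Set.Icc (0 : ℝ) 1, |x - y| < δ →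
      |tollLimit x - tollLimit y| < η := by
    have := (isCompact_Icc (a := (0 : ℝ)) (b := 1)).uniformContinuousOn_of_continuous
      continuous_tollLimit.continuousOn
    rw [Metric.uniformContinuousOn_iff] at this
    simpa only [Real.dist_eq] using this
  obtain ⟨δ₁, hδ₁, h₁⟩ := huc (ε / 4) (by positivity)
  obtain ⟨δ₂, hδ₂, h₂⟩ := hut (ε / (4 * (T + 1))) (by positivity)
  have hlim : ∀ c η : ℝ, 0 < η → ∀ᶠ n : ℕ in atTop, c / n < η := fun c η hη =>
    (tendsto_const_div_atTop_nhds_zero_nat c).eventually (gt_mem_nhds hη)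
  obtain ⟨N, hN⟩ := eventually_atTop.1 (((hlim T δ₁ hδ₁).and (hlim 1 δ₂ hδ₂)).and
    ((hlim (T * 13) (ε / 4) (by positivity)).and (eventually_ge_atTop 1)))
  refine ⟨N, fun n hn t ht => ?_⟩
  obtain ⟨⟨hn1, hn2⟩, hn3, hn4⟩ := hN n hn
  have hn0 : (0 : ℝ) < n := by exact_mod_cast hn4
  refine norm_sum_sub_integral_le (by fun_prop) hn4 _ fun i hi u hu1 hu2 => ?_
  have hi1 : (i : ℝ) + 1 ≤ n := by exact_mod_cast hi
  have hi0 : (0 : ℝ) ≤ i := Nat.cast_nonneg i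
  have hij : ((n - 1 - i : ℕ) : ℝ) / n = 1 - (i + 1) / n := by
    rw [Nat.cast_sub (by omega), Nat.cast_sub hn4]
    field_simp
    push_cast
    ring
  have hin : (i : ℝ) / n = (i + 1) / n - 1 / n := by ring
  have hu0 : 0 ≤ u := le_trans (by positivity) hu1
  have hi2 : ((i : ℝ) + 1) / n ≤ 1 := by rwa [div_le_one hn0]
  have hi3 : 0 ≤ (i : ℝ) / n := by positivity
  have hu1' : u ≤ 1 := hu2.trans hi2
  have hmem : ∀ c : ℝ, 0 ≤ c → c ≤ 1 → c * t ∈ Set.Icc (-T) T := by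
    intro c hc0 hc1
    rw [Set.mem_Icc, ← abs_le, abs_mul, abs_of_nonneg hc0]
    exact (mul_le_of_le_one_left (abs_nonneg t) hc1).trans ht
  have hclose : ∀ c d : ℝ, |c - d| ≤ 1 / n → |c * t - d * t| < δ₁ := by
    intro c d hcd
    rw [← sub_mul, abs_mul]
    calc |c - d| * |t| ≤ 1 / n * T := by gcongr
      _ = T / n := by ring
      _ < δ₁ := hn1
  have hv0 : (i : ℝ) / n ≤ (i + 1) / (n + 1) := by
    rw [div_le_div_iff₀ hn0 (by positivity)]; nlinarith
  have hv1 : ((i : ℝ) + 1) / (n + 1) ≤ (i + 1) / n := by gcongr; linarith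
  refine (norm_mul_mul_sub_mul_mul_le (hg1 _) (norm_exp_ofReal_mul_ofReal_mul_I _ _).le (hg1 _)
    (hg1 _)).trans ?_
  have e1 : ‖g (i / n * t) - g (u * t)‖ < ε / 4 := by
    refine h₁ _ (hmem _ hi3 (by linarith)) _ (hmem _ hu0 hu1') (hclose _ _ ?_)
    rw [abs_le]; constructor <;> linarith
  have e2 : ‖g ((n - 1 - i : ℕ) / n * t) - g ((1 - u) * t)‖ < ε / 4 := by
    rw [hij]
    refine h₁ _ (hmem _ (by linarith) (by linarith)) _ (hmem _ (by linarith) (by linarith))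
      (hclose _ _ ?_)
    rw [abs_le]; constructor <;> linarith
  have e3 := norm_exp_mul_I_sub_exp_mul_I_le t (quicksortToll n i / n) (tollLimit u)
  have e4 : |quicksortToll n i / n - tollLimit u| ≤ 13 / n + ε / (4 * (T + 1)) := by
    have e5 := abs_toll_div_sub_tollLimit_le hi
    have e6 := h₂ (((i : ℝ) + 1) / (n + 1)) ⟨by positivity, by linarith⟩ u ⟨hu0, hu1'⟩ (by
      refine lt_of_le_of_lt ?_ hn2
      rw [abs_le]; constructor <;> linarith)
    calc _ ≤ _ := abs_sub_le _ (tollLimit (((i : ℝ) + 1) / (n + 1))) _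
      _ ≤ _ := add_le_add e5 e6.le
  have e7 : |t| * |quicksortToll n i / n - tollLimit u| ≤ ε / 4 + ε / 4 := by
    calc _ ≤ T * (13 / n + ε / (4 * (T + 1))) := by gcongr
      _ = T * 13 / n + T / (T + 1) * (ε / 4) := by field_simp
      _ ≤ ε / 4 + 1 * (ε / 4) := by
          gcongr
          rw [div_le_one (by positivity)]
          linarith
      _ = _ := by ring
  linarith

/-- One pass through the recursion improves the asymptotic constant A to 2A/3. The finitely many
sizes i < N₁ not covered by the hypothesis are bounded crudely through K and contribute O(1/n). -/
theorem quicksortChar_dist_contraction {g : ℝ → ℂ} (hg : Continuous g) (hg1 : ∀ t, ‖g t‖ ≤ 1)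
    (hfix : ∀ t, quicksortOp g t = g t) {K : ℝ} (hK : 0 ≤ K)
    (hKb : ∀ n t, ‖quicksortChar n t - g t‖ ≤ K * t ^ 2) {T A : ℝ} (hA : 0 ≤ A)
    (h : ∀ ε > 0, ∃ N : ℕ, ∀ n ≥ N, ∀ t, |t| ≤ T → ‖quicksortChar n t - g t‖ ≤ A * t ^ 2 + ε) :
    ∀ ε > 0, ∃ N : ℕ, ∀ n ≥ N, ∀ t, |t| ≤ T →
      ‖quicksortChar n t - g t‖ ≤ 2 / 3 * A * t ^ 2 + ε := by
  intro ε hε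
  obtain ⟨N₁, h₁⟩ := h (ε / 8) (by positivity)
  obtain ⟨N₂, h₂⟩ := exists_riemann_sum_close hg hg1 T (ε := ε / 4) (by positivity)
  obtain ⟨N, hN⟩ := eventually_atTop.1 ((eventually_ge_atTop N₂).and
    (((tendsto_const_div_atTop_nhds_zero_nat (2 * N₁ * (K * T ^ 2))).eventually
      (gt_mem_nhds (by positivity : 0 < ε / 4))).and (eventually_ge_atTop 1)))
  refine ⟨N, fun n hn t ht => ?_⟩
  obtain ⟨hn2, hn3, hn4⟩ := hN n hn
  have hn0 : (0 : ℝ) < n := by exact_mod_cast hn4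
  have ht2 : t ^ 2 ≤ T ^ 2 := by rw [← sq_abs t]; gcongr
  set d : ℕ → ℝ := fun i => ‖quicksortChar i (i / n * t) - g (i / n * t)‖ with hd
  have hsub : ∀ i < n, |(i : ℝ) / n * t| ≤ T ∧ ((i : ℝ) / n) ^ 2 ≤ 1 := by
    intro i hi
    have h0 : (0 : ℝ) ≤ i / n := by positivity
    have h1 : (i : ℝ) / n ≤ 1 := by rw [div_le_one hn0]; exact_mod_cast hi.le
    refine ⟨?_, pow_le_one₀ h0 h1⟩
    rw [abs_mul, abs_of_nonneg h0]
    exact (mul_le_of_le_one_left (abs_nonneg t) h1).trans ht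
  have hdi : ∀ i ∈ Finset.range n,
      d i ≤ A * t ^ 2 / n ^ 2 * (i : ℝ) ^ 2 + ε / 8 + if i < N₁ then K * T ^ 2 else 0 := by
    intro i hi
    obtain ⟨hi1, hi2⟩ := hsub i (Finset.mem_range.1 hi)
    split_ifs with hiN
    · have : d i ≤ K * T ^ 2 := by
        refine (hKb _ _).trans ?_
        rw [mul_pow]
        gcongr
        exact (mul_le_of_le_one_left (sq_nonneg t) hi2).trans ht2
      have : 0 ≤ A * t ^ 2 / n ^ 2 * (i : ℝ) ^ 2 := by positivity
      linarith
    · refine (h₁ i (not_lt.1 hiN) _ hi1).trans_eq ?_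
      ring
  have hsum : ∑ i ∈ Finset.range n, d i
      ≤ A * t ^ 2 / n ^ 2 * (n ^ 3 / 3) + n * (ε / 8) + N₁ * (K * T ^ 2) := by
    refine (Finset.sum_le_sum hdi).trans ?_
    rw [Finset.sum_add_distrib, Finset.sum_add_distrib, ← Finset.mul_sum]
    gcongr
    · exact sum_range_sq_le n
    · simp
    · rw [← Finset.sum_filter, Finset.sum_const, nsmul_eq_mul]
      gcongr
      refine (Finset.card_le_card (t := Finset.range N₁) fun x hx => ?_).trans_eq (by simp)
      simp only [Finset.mem_filter, Finset.mem_range] at hx ⊢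
      exact hx.2
  have hmain : ‖(n : ℂ)⁻¹ * ∑ i ∈ Finset.range n,
        quicksortChar i (i / n * t) * quicksortChar (n - 1 - i) ((n - 1 - i : ℕ) / n * t)
          * Complex.exp (t * (quicksortToll n i / n : ℝ) * Complex.I)
      - (n : ℂ)⁻¹ * ∑ i ∈ Finset.range n, g (i / n * t) * g ((n - 1 - i : ℕ) / n * t)
        * Complex.exp (t * (quicksortToll n i / n : ℝ) * Complex.I)‖
      ≤ (n : ℝ)⁻¹ * (2 * ∑ i ∈ Finset.range n, d i) := by
    rw [← mul_sub, ← Finset.sum_sub_distrib, norm_mul, norm_inv, Complex.norm_natCast]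
    gcongr
    rw [two_mul]
    -- Reflection i ↦ n-1-i turns the errors of the second factor into those of the first, whence
    -- the factor 2.
    nth_rw 2 [← Finset.sum_range_reflect]
    rw [← Finset.sum_add_distrib]
    refine norm_sum_le_of_le _ fun i _ => ?_
    refine (norm_mul_mul_sub_mul_mul_le (norm_quicksortChar_le_one _ _)
      (norm_exp_ofReal_mul_ofReal_mul_I _ _).le (hg1 _) (hg1 _)).trans ?_
    rw [sub_self, norm_zero, add_zero, add_comm (d _)]
  have hR := h₂ n hn2 t ht
  rw [hfix] at hR
  rw [quicksortChar_rec hn4]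
  refine (norm_sub_le_norm_sub_add_norm_sub _ _ _).trans ((add_le_add hmain hR).trans ?_)
  have hfin : (n : ℝ)⁻¹ * (2 * ∑ i ∈ Finset.range n, d i)
      ≤ 2 / 3 * A * t ^ 2 + ε / 4 + 2 * N₁ * (K * T ^ 2) / n := by
    calc _ ≤ (n : ℝ)⁻¹ * (2 * (A * t ^ 2 / n ^ 2 * (n ^ 3 / 3) + n * (ε / 8)
          + N₁ * (K * T ^ 2))) := by gcongr
      _ = _ := by field_simp; ring
  linarith

/-- The characteristic functions of the standardized numbers of comparisons converge to a
continuous fixed point of the Quicksort recursion. -/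
theorem exists_tendsto_quicksortChar : ∃ g : ℝ → ℂ, Continuous g ∧ (∀ t, ‖g t‖ ≤ 1) ∧
    (∀ t, quicksortOp g t = g t) ∧ ∀ t, Tendsto (fun n => quicksortChar n t) atTop (𝓝 (g t)) := by
  obtain ⟨g, hg, hg1, hgK, hfix⟩ := exists_quicksortOp_fixedPoint
  obtain ⟨K, hK, hKb⟩ := exists_norm_quicksortChar_sub_one_le
  refine ⟨g, hg, hg1, hfix, fun t => ?_⟩
  have hKb' : ∀ n t, ‖quicksortChar n t - g t‖ ≤ (K + 225) * t ^ 2 := by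
    intro n t
    refine (norm_sub_le_norm_sub_add_norm_sub _ 1 _).trans ?_
    rw [norm_sub_rev 1]
    linarith [hKb n t, hgK t]
  -- The threshold N may depend on k: first k is fixed so that the main term is small, then n grows.
  have hall : ∀ k : ℕ, ∀ ε > 0, ∃ N : ℕ, ∀ n ≥ N, ∀ s, |s| ≤ |t| →
      ‖quicksortChar n s - g s‖ ≤ (2 / 3) ^ k * (K + 225) * s ^ 2 + ε := by
    intro k
    induction k with
    | zero => exact fun ε hε => ⟨0, fun n _ s _ => by linarith [hKb' n s]⟩
    | succ k ih =>
      have := quicksortChar_dist_contraction hg hg1 hfix (by positivity) hKb' (by positivity) ih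
      intro ε hε
      obtain ⟨N, hN⟩ := this ε hε
      exact ⟨N, fun n hn s hs => (hN n hn s hs).trans_eq (by ring)⟩
  rw [Metric.tendsto_atTop]
  intro ε hε
  have hpow : Tendsto (fun k : ℕ => (2 / 3 : ℝ) ^ k * ((K + 225) * t ^ 2)) atTop (𝓝 0) := by
    simpa using (tendsto_pow_atTop_nhds_zero_of_lt_one (by norm_num : (0 : ℝ) ≤ 2 / 3)
      (by norm_num)).mul_const ((K + 225) * t ^ 2)
  obtain ⟨k, hk⟩ := (hpow.eventually (gt_mem_nhds (by positivity : 0 < ε / 2))).exists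
  obtain ⟨N, hN⟩ := hall k (ε / 2) (by positivity)
  refine ⟨N, fun n hn => ?_⟩
  rw [dist_eq_norm]
  linarith [hN n hn t le_rfl]

/-! ### The limit law and its moments. -/

/-- The law of the standardized number of comparisons on `n` keys. -/
noncomputable def quicksortYLaw (n : ℕ) : ProbabilityMeasure ℝ :=
  ⟨(quicksortLaw n).toMeasure.map (quicksortY n),
    Measure.isProbabilityMeasure_map (Measurable.of_discrete.aemeasurable)⟩

theorem charFun_quicksortYLaw (n : ℕ) (t : ℝ) :
    charFun (quicksortYLaw n : Measure ℝ) t = quicksortChar n t := by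
  rw [charFun_apply_real, quicksortYLaw, ProbabilityMeasure.coe_mk,
    integral_map Measurable.of_discrete.aemeasurable (by fun_prop), quicksortChar]

/-- Lévy's continuity theorem: continuity of g at 0 gives tightness, Prokhorov's theorem gives a
limit point along an ultrafilter, and its characteristic function must be g, which forces
convergence of the whole sequence. -/
theorem ProbabilityMeasure.exists_tendsto_of_tendsto_charFun {μ : ℕ → ProbabilityMeasure ℝ}
    {g : ℝ → ℂ} (hg : Continuous g)
    (h : ∀ t, Tendsto (fun n => charFun (μ n : Measure ℝ) t) atTop (𝓝 (g t))) :
    ∃ F : ProbabilityMeasure ℝ, charFun (F : Measure ℝ) = g ∧ Tendsto μ atTop (𝓝 F) := by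
  have htight : IsTightMeasureSet (Set.range fun n => (μ n : Measure ℝ)) :=
    isTightMeasureSet_of_tendsto_charFun hg.continuousAt h
  have hcomp : IsCompact (closure (Set.range μ)) := by
    refine isCompact_closure_of_isTightMeasureSet (htight.subset ?_)
    rintro _ ⟨_, ⟨n, rfl⟩, rfl⟩
    exact ⟨n, rfl⟩
  obtain ⟨F, -, hF⟩ := hcomp.ultrafilter_le_nhds ((hyperfilter ℕ).map μ)
    (le_trans (by simp) (Filter.monotone_principal subset_closure))
  have hF' : Tendsto μ (hyperfilter ℕ) (𝓝 F) := hF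
  have hchar : charFun (F : Measure ℝ) = g := by
    funext t
    refine tendsto_nhds_unique ?_ ((h t).mono_left Nat.hyperfilter_le_atTop)
    rw [ProbabilityMeasure.tendsto_iff_forall_integral_rclike_tendsto ℂ] at hF'
    simp_rw [charFun_eq_integral_innerProbChar]
    exact hF' _
  refine ⟨F, hchar, ProbabilityMeasure.tendsto_of_tendsto_charFun fun t => ?_⟩
  rw [hchar]
  exact h t

theorem isQuicksortLimit_of_tendsto {F : ProbabilityMeasure ℝ}
    (hF : Tendsto quicksortYLaw atTop (𝓝 F)) : IsQuicksortLimit F := by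
  intro A hA
  have hmeas : ∀ n, AEMeasurable (quicksortStandardized (A n))
      (quicksortComparisons (A n)).toMeasure := fun n => Measurable.of_discrete.aemeasurable
  have hfun : ∀ n, quicksortStandardized (A n) = quicksortY n := by
    intro n
    funext x
    rw [quicksortStandardized, quicksortY, quicksortMean, quicksortExpectation,
      quicksortComparisons_eq_law, hA]
  refine ⟨hmeas, aemeasurable_id, ?_⟩
  have h1 : (⟨(F : Measure ℝ).map id, Measure.isProbabilityMeasure_map aemeasurable_id⟩ :
      ProbabilityMeasure ℝ) = F := by
    apply Subtype.ext
    simp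
  rw [h1]
  refine hF.congr fun n => ?_
  apply Subtype.ext
  simp only [quicksortYLaw]
  rw [hfun, quicksortComparisons_eq_law, hA]

/-- Fatou's lemma for weak convergence, from the portmanteau inequality on open sets. -/
theorem integrable_exp_mul_abs_of_tendsto {μ : ℕ → ProbabilityMeasure ℝ} {F : ProbabilityMeasure ℝ}
    (hF : Tendsto μ atTop (𝓝 F)) {l B : ℝ}
    (hi : ∀ n, Integrable (fun y => Real.exp (l * |y|)) (μ n : Measure ℝ))
    (hB : ∀ n, ∫ y, Real.exp (l * |y|) ∂(μ n : Measure ℝ) ≤ B) :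
    Integrable (fun y => Real.exp (l * |y|)) (F : Measure ℝ) := by
  have hc : Continuous fun y : ℝ => Real.exp (l * |y|) := by fun_prop
  refine ⟨hc.aestronglyMeasurable, ?_⟩
  rw [hasFiniteIntegral_iff_ofReal (.of_forall fun y => (Real.exp_pos _).le)]
  have h := lintegral_le_liminf_lintegral_of_forall_isOpen_measure_le_liminf_measure
    (μ := (F : Measure ℝ)) (μs := fun n => (μ n : Measure ℝ)) hc (fun y => (Real.exp_pos _).le)
    fun G hG => ProbabilityMeasure.le_liminf_measure_open_of_tendsto hF hG
  refine (h.trans ?_).trans_lt (ENNReal.ofReal_lt_top (r := B))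
  refine liminf_le_of_le (by isBoundedDefault) fun b hb => ?_
  obtain ⟨n, hn⟩ := hb.exists
  refine hn.trans ?_
  rw [← ofReal_integral_eq_lintegral_ofReal (hi n) (.of_forall fun y => (Real.exp_pos _).le)]
  exact ENNReal.ofReal_le_ofReal (hB n)

theorem memLp_id_of_integrable_exp_mul_abs {μ : Measure ℝ} [IsFiniteMeasure μ] {l : ℝ} (hl : 0 < l)
    (h : Integrable (fun y => Real.exp (l * |y|)) μ) (k : ℕ) : MemLp id k μ := by
  have h0 : (0 : ℝ) ∈ interior (integrableExpSet id μ) := by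
    rw [mem_interior_iff_mem_nhds]
    filter_upwards [Ioo_mem_nhds (neg_lt_zero.2 hl) hl] with s hs
    refine h.mono' (by fun_prop) (.of_forall fun y => ?_)
    rw [Real.norm_eq_abs, Real.abs_exp, id]
    refine Real.exp_le_exp.2 ?_
    calc s * y ≤ |s * y| := le_abs_self _
      _ = |s| * |y| := abs_mul _ _
      _ ≤ l * |y| := by gcongr; exact (abs_lt.2 hs).le
  simpa using memLp_of_mem_interior_integrableExpSet h0 k

/-- The limiting Quicksort distribution: its moments are finite and its characteristic function
is a fixed point of the Quicksort recursion. -/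
theorem exists_quicksortLimit : ∃ F : ProbabilityMeasure ℝ, IsQuicksortLimit F ∧
    (∀ k : ℕ, MemLp id k (F : Measure ℝ)) ∧
    ∀ t, quicksortOp (charFun (F : Measure ℝ)) t = charFun (F : Measure ℝ) t := by
  obtain ⟨g, hg, -, hfix, hlim⟩ := exists_tendsto_quicksortChar
  obtain ⟨F, hFg, hF⟩ := ProbabilityMeasure.exists_tendsto_of_tendsto_charFun
    (μ := quicksortYLaw) hg (by simpa only [charFun_quicksortYLaw] using hlim)
  obtain ⟨l, hl, B, hB⟩ := exists_exp_moment_bound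
  have hm : ∀ n, AEMeasurable (quicksortY n) (quicksortLaw n).toMeasure :=
    fun n => Measurable.of_discrete.aemeasurable
  refine ⟨F, isQuicksortLimit_of_tendsto hF, memLp_id_of_integrable_exp_mul_abs hl
    (integrable_exp_mul_abs_of_tendsto hF (B := B) (fun n => ?_) fun n => ?_), by rwa [hFg]⟩
  · rw [quicksortYLaw, ProbabilityMeasure.coe_mk, integrable_map_measure (by fun_prop) (hm n)]
    exact integrable_quicksortLaw _ _
  · rw [quicksortYLaw, ProbabilityMeasure.coe_mk, integral_map (hm n) (by fun_prop)]
    exact hB n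

/-! ### Van der Corput estimate for the Quicksort phase. -/

/-- The first derivative test for oscillatory integrals with a convex phase. -/
theorem norm_integral_exp_le_of_le_abs_deriv {f w w' : ℝ → ℝ} {a b t l : ℝ} (hab : a ≤ b)
    (hf : ∀ x ∈ Set.Icc a b, HasDerivAt f (w x) x) (hw : ∀ x ∈ Set.Icc a b, HasDerivAt w (w' x) x)
    (hw' : ContinuousOn w' (Set.Icc a b)) (hw0 : ∀ x ∈ Set.Icc a b, 0 ≤ w' x) (hl : 0 < l)
    (hlw : ∀ x ∈ Set.Icc a b, l ≤ |w x|) (ht : t ≠ 0) :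
    ‖∫ x in a..b, Complex.exp ((t * f x : ℝ) * Complex.I)‖ ≤ 4 / (l * |t|) := by
  have hI := Set.uIcc_of_le hab
  have hne : ∀ x ∈ Set.Icc a b, w x ≠ 0 := fun x hx h0 => by
    have := hlw x hx
    rw [h0, abs_zero] at this
    linarith
  have hwc : ContinuousOn w (Set.Icc a b) := fun x hx => (hw x hx).continuousAt.continuousWithinAt
  have hfc : ContinuousOn f (Set.Icc a b) := fun x hx => (hf x hx).continuousAt.continuousWithinAt
  set r : ℝ → ℝ := fun x => (w x)⁻¹ with hr
  set r' : ℝ → ℝ := fun x => -w' x / w x ^ 2 with hr'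
  have hrd : ∀ x ∈ Set.Icc a b, HasDerivAt r (r' x) x := fun x hx => (hw x hx).inv (hne x hx)
  have hr'c : ContinuousOn r' (Set.Icc a b) := hw'.neg.div (hwc.pow 2) fun x hx =>
    pow_ne_zero _ (hne x hx)
  set E : ℝ → ℂ := fun x => Complex.exp ((t * f x : ℝ) * Complex.I) with hE
  have hE1 : ∀ x, ‖E x‖ = 1 := fun x => Complex.norm_exp_ofReal_mul_I _
  have hEc : ContinuousOn E (Set.Icc a b) := by
    have : ContinuousOn (fun x => ((t * f x : ℝ) : ℂ)) (Set.Icc a b) :=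
      Complex.continuous_ofReal.comp_continuousOn (hfc.const_smul t)
    exact (this.mul continuousOn_const).cexp
  have hEd : ∀ x ∈ Set.Icc a b,
      HasDerivAt (fun x => E x / (t * Complex.I)) (E x * w x) x := by
    intro x hx
    have h1 : HasDerivAt (fun x => ((t * f x : ℝ) : ℂ) * Complex.I) ((t * w x : ℝ) * Complex.I) x :=
      (((hf x hx).const_mul t).ofReal_comp).mul_const _
    have h2 := h1.cexp.div_const (t * Complex.I)
    convert! h2 using 1
    have htc : (t : ℂ) ≠ 0 := by exact_mod_cast ht
    simp only [hE]
    push_cast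
    field_simp
  have hrI : IntervalIntegrable (fun x => (r' x : ℂ)) volume a b := by
    apply ContinuousOn.intervalIntegrable
    rw [hI]
    exact Complex.continuous_ofReal.comp_continuousOn hr'c
  -- Integration by parts after writing E = (1/w)·(E w), where E w is the derivative of E/(it).
  have hparts := intervalIntegral.integral_mul_deriv_eq_deriv_mul (a := a) (b := b)
    (u := fun x => (r x : ℂ)) (u' := fun x => (r' x : ℂ)) (v := fun x => E x / (t * Complex.I))
    (v' := fun x => E x * w x) (fun x hx => (hrd x (hI ▸ hx)).ofReal_comp)
    (fun x hx => hEd x (hI ▸ hx)) hrI (by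
      apply ContinuousOn.intervalIntegrable
      rw [hI]
      exact hEc.mul (Complex.continuous_ofReal.comp_continuousOn hwc))
  have heq : ∫ x in a..b, E x = ∫ x in a..b, (r x : ℂ) * (E x * w x) := by
    refine intervalIntegral.integral_congr fun x hx => ?_
    have h1 : (w x : ℂ) ≠ 0 := by exact_mod_cast hne x (hI ▸ hx)
    simp only [hr]
    push_cast
    field_simp
  have hrb : ∀ x ∈ Set.Icc a b, |r x| ≤ 1 / l := by
    intro x hx
    rw [hr, abs_inv, ← one_div]
    exact one_div_le_one_div_of_le hl (hlw x hx)
  have hEn : ∀ x, ‖E x / (t * Complex.I)‖ = 1 / |t| := by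
    intro x
    rw [norm_div, hE1]
    simp
  have ha := hrb a (Set.left_mem_Icc.2 hab)
  have hb := hrb b (Set.right_mem_Icc.2 hab)
  -- Convexity enters here: 1/w is decreasing, so the integral of |r'| telescopes to r a - r b.
  have hint : ‖∫ x in a..b, (r' x : ℂ) * (E x / (t * Complex.I))‖ ≤ (1 / l + 1 / l) * (1 / |t|) := by
    calc _ ≤ ∫ x in a..b, -r' x * (1 / |t|) := by
          refine intervalIntegral.norm_integral_le_of_norm_le hab ?_ ?_
          · refine .of_forall fun x hx => ?_
            rw [norm_mul, hEn, Complex.norm_real, Real.norm_eq_abs, abs_of_nonpos]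
            have := hw0 x (Set.Ioc_subset_Icc_self hx)
            rw [hr']
            simp only [neg_div, Left.neg_nonpos_iff]
            positivity
          · apply ContinuousOn.intervalIntegrable
            rw [hI]
            exact hr'c.neg.mul continuousOn_const
      _ = (r a - r b) * (1 / |t|) := by
          rw [intervalIntegral.integral_mul_const, intervalIntegral.integral_neg,
            intervalIntegral.integral_eq_sub_of_hasDerivAt (fun x hx => hrd x (hI ▸ hx))
            (by apply ContinuousOn.intervalIntegrable; rwa [hI]), neg_sub]
      _ ≤ _ := by
          gcongr
          rw [abs_le] at ha hb
          linarith
  rw [heq, hparts]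
  calc _ ≤ ‖(r b : ℂ) * (E b / (t * Complex.I))‖ + ‖(r a : ℂ) * (E a / (t * Complex.I))‖
        + ‖∫ x in a..b, (r' x : ℂ) * (E x / (t * Complex.I))‖ :=
        (norm_sub_le _ _).trans (by gcongr; exact norm_sub_le _ _)
    _ ≤ 1 / l * (1 / |t|) + 1 / l * (1 / |t|) + (1 / l + 1 / l) * (1 / |t|) := by
        rw [norm_mul, norm_mul, hEn, hEn, Complex.norm_real, Complex.norm_real]
        gcongr
        · exact hb
        · exact ha
    _ = _ := by
        have := abs_pos.2 ht
        field_simp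
        norm_num

/-- The phase of the Quicksort recursion with the values of both subarrays fixed. -/
noncomputable def quicksortPhase (y z u : ℝ) : ℝ := u * y + (1 - u) * z + tollLimit u

theorem continuous_quicksortPhase :
    Continuous fun p : ℝ × ℝ × ℝ => quicksortPhase p.1 p.2.1 p.2.2 := by
  unfold quicksortPhase
  fun_prop

/-- The derivative of the Quicksort phase. -/
noncomputable def quicksortPhaseDeriv (y z u : ℝ) : ℝ :=
  y - z + 2 * Real.log u - 2 * Real.log (1 - u)

theorem hasDerivAt_quicksortPhase (y z : ℝ) {u : ℝ} (h0 : 0 < u) (h1 : u < 1) :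
    HasDerivAt (quicksortPhase y z) (quicksortPhaseDeriv y z u) u := by
  have hv : 1 - u ≠ 0 := (sub_pos.2 h1).ne'
  have e1 : HasDerivAt (fun u : ℝ => u * Real.log u) (Real.log u + 1) u := by
    have := (hasDerivAt_id u).mul (Real.hasDerivAt_log h0.ne')
    convert! this using 1
    simp [h0.ne']
  have e0 : HasDerivAt (fun u : ℝ => 1 - u) (-1) u := by
    simpa using (hasDerivAt_id u).const_sub 1
  have e2 : HasDerivAt (fun u : ℝ => (1 - u) * Real.log (1 - u)) (-Real.log (1 - u) - 1) u := by
    have := e0.mul (e0.log hv)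
    convert! this using 1
    field_simp
    ring
  have e3 := (((hasDerivAt_id u).mul_const y).add (e0.mul_const z)).add
    (((e1.const_mul 2).const_add 1).add (e2.const_mul 2))
  convert! e3 using 1
  rw [quicksortPhaseDeriv]
  ring

theorem hasDerivAt_quicksortPhaseDeriv (y z : ℝ) {u : ℝ} (h0 : 0 < u) (h1 : u < 1) :
    HasDerivAt (quicksortPhaseDeriv y z) (2 / u + 2 / (1 - u)) u := by
  have hv : 1 - u ≠ 0 := (sub_pos.2 h1).ne'
  have e0 : HasDerivAt (fun u : ℝ => 1 - u) (-1) u := by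
    simpa using (hasDerivAt_id u).const_sub 1
  have e3 := (((Real.hasDerivAt_log h0.ne').const_mul 2).const_add (y - z)).sub
    ((e0.log hv).const_mul 2)
  convert! e3 using 1
  field_simp
  ring

theorem sub_le_log_sub_log {a b : ℝ} (ha : 0 < a) (hab : a ≤ b) (hb : b ≤ 1) :
    b - a ≤ Real.log b - Real.log a := by
  have hb0 : 0 < b := ha.trans_le hab
  have h := Real.one_sub_inv_le_log_of_pos (div_pos hb0 ha)
  rw [Real.log_div hb0.ne' ha.ne', inv_div] at h
  refine le_trans ?_ h
  have h1 : 1 - a / b = (b - a) / b := by field_simp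
  rw [h1, le_div_iff₀ hb0]
  nlinarith

/-- The derivative is y - z plus twice the log-odds of u, so it vanishes where the odds equal
exp((z-y)/2). Each of the two logarithmic terms grows with slope at least 2 on (0, 1). -/
theorem exists_abs_quicksortPhaseDeriv_ge (y z : ℝ) : ∃ c ∈ Set.Ioo (0 : ℝ) 1,
    ∀ u ∈ Set.Ioo (0 : ℝ) 1, 4 * |u - c| ≤ |quicksortPhaseDeriv y z u| := by
  set e := Real.exp ((z - y) / 2) with he
  have he0 : 0 < e := Real.exp_pos _
  have h1c : 1 - e / (1 + e) = 1 / (1 + e) := by field_simp; ring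
  have hc : e / (1 + e) ∈ Set.Ioo (0 : ℝ) 1 := by
    refine ⟨by positivity, ?_⟩
    rw [div_lt_one (by positivity)]
    linarith
  have hz : quicksortPhaseDeriv y z (e / (1 + e)) = 0 := by
    rw [quicksortPhaseDeriv, h1c, Real.log_div he0.ne' (by positivity),
      Real.log_div one_ne_zero (by positivity), Real.log_one, he, Real.log_exp]
    ring
  refine ⟨_, hc, fun u hu => ?_⟩
  set c := e / (1 + e)
  have hmono : ∀ p q : ℝ, 0 < p → p ≤ q → q < 1 →
      4 * (q - p) ≤ quicksortPhaseDeriv y z q - quicksortPhaseDeriv y z p := by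
    intro p q hp hpq hq
    have e1 := sub_le_log_sub_log hp hpq hq.le
    have e2 := sub_le_log_sub_log (sub_pos.2 hq) (sub_le_sub_left hpq 1) (by linarith)
    rw [quicksortPhaseDeriv, quicksortPhaseDeriv]
    linarith
  rcases le_total c u with h | h
  · have := hmono c u hc.1 h hu.2
    rw [hz, sub_zero] at this
    rw [abs_of_nonneg (sub_nonneg.2 h)]
    exact this.trans (le_abs_self _)
  · have := hmono u c hu.1 h hc.2
    rw [hz, zero_sub] at this
    rw [abs_of_nonpos (sub_nonpos.2 h), neg_sub]
    exact this.trans (neg_le_abs _)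

/-- Van der Corput's bound for the Quicksort phase. -/
theorem norm_integral_exp_quicksortPhase_le (y z : ℝ) {t : ℝ} (ht : t ≠ 0) :
    ‖∫ u in (0 : ℝ)..1, Complex.exp ((t * quicksortPhase y z u : ℝ) * Complex.I)‖
      ≤ 6 * |t| ^ (-(1 / 2) : ℝ) := by
  obtain ⟨c, hc, hcd⟩ := exists_abs_quicksortPhaseDeriv_ge y z
  have ht0 : 0 < |t| := abs_pos.2 ht
  -- This δ balances the two bounds: lengths of order δ are estimated trivially near c and near the
  -- endpoints, where the logarithms blow up, while elsewhere the derivative is at least 4δ and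
  -- contributes 4/(4δ|t|) = δ. The left, middle and right portions cost at most 2δ each.
  set δ : ℝ := |t| ^ (-(1 / 2) : ℝ) with hδ
  have hδ0 : 0 < δ := Real.rpow_pos_of_pos ht0 _
  have hδt : δ * δ * |t| = 1 := by
    rw [hδ, ← Real.rpow_add ht0]
    norm_num
    rw [Real.rpow_neg_one, inv_mul_cancel₀ ht0.ne']
  have hphc : Continuous (quicksortPhase y z) :=
    continuous_quicksortPhase.comp (by fun_prop : Continuous fun u : ℝ => (y, z, u))
  set E : ℝ → ℂ := fun u => Complex.exp ((t * quicksortPhase y z u : ℝ) * Complex.I) with hE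
  have hEc : Continuous E := by fun_prop
  have hEi : ∀ a b, IntervalIntegrable E volume a b := fun a b => hEc.intervalIntegrable a b
  have htriv : ∀ a b : ℝ, a ≤ b → ‖∫ u in a..b, E u‖ ≤ b - a := by
    intro a b hab
    have := intervalIntegral.norm_integral_le_of_norm_le_const (a := a) (b := b) (C := 1) (f := E)
      fun u _ => (Complex.norm_exp_ofReal_mul_I _).le
    rwa [one_mul, abs_of_nonneg (sub_nonneg.2 hab)] at this
  have hpiece : ∀ a b : ℝ, 0 < a → a ≤ b → b < 1 → (∀ u ∈ Set.Icc a b, δ ≤ |u - c|) →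
      ‖∫ u in a..b, E u‖ ≤ δ := by
    intro a b ha hab hb hu
    have hmem : ∀ x ∈ Set.Icc a b, 0 < x ∧ x < 1 := fun x hx =>
      ⟨ha.trans_le hx.1, hx.2.trans_lt hb⟩
    refine (norm_integral_exp_le_of_le_abs_deriv (w := quicksortPhaseDeriv y z)
      (w' := fun u => 2 / u + 2 / (1 - u)) (l := 4 * δ) hab
      (fun x hx => hasDerivAt_quicksortPhase y z (hmem x hx).1 (hmem x hx).2)
      (fun x hx => hasDerivAt_quicksortPhaseDeriv y z (hmem x hx).1 (hmem x hx).2)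
      ?_ (fun x hx => ?_) (by positivity) (fun x hx => ?_) ht).trans_eq ?_
    · refine (continuousOn_const.div continuousOn_id fun x hx => (hmem x hx).1.ne').add
        (continuousOn_const.div (continuousOn_const.sub continuousOn_id) fun x hx => ?_)
      exact (sub_pos.2 (hmem x hx).2).ne'
    · have h1 := (hmem x hx).1
      have h2 := sub_pos.2 (hmem x hx).2
      positivity
    · refine le_trans ?_ (hcd x (hmem x hx))
      linarith [hu x hx]
    · rw [div_eq_iff (by positivity)]
      linear_combination (-4 : ℝ) * hδt
  have hleft : ‖∫ u in (0 : ℝ)..(max 0 (c - δ)), E u‖ ≤ 2 * δ := by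
    rcases le_total (c - δ) δ with h | h
    · refine (htriv _ _ (le_max_left _ _)).trans ?_
      rw [sub_zero]
      exact max_le (by positivity) (by linarith)
    · rw [max_eq_right (by linarith), ← intervalIntegral.integral_add_adjacent_intervals
        (hEi 0 δ) (hEi δ (c - δ))]
      refine (norm_add_le _ _).trans ?_
      have h1 := htriv 0 δ hδ0.le
      have h2 := hpiece δ (c - δ) hδ0 h (by linarith [hc.2]) fun u hu => by
        rw [abs_of_nonpos (by linarith [hu.2])]; linarith [hu.2]
      linarith
  have hright : ‖∫ u in (min 1 (c + δ))..1, E u‖ ≤ 2 * δ := by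
    rcases le_total (1 - δ) (c + δ) with h | h
    · refine (htriv _ _ (min_le_left _ _)).trans ?_
      rw [sub_le_comm]
      exact le_min (by linarith) (by linarith)
    · rw [min_eq_right (by linarith), ← intervalIntegral.integral_add_adjacent_intervals
        (hEi (c + δ) (1 - δ)) (hEi (1 - δ) 1)]
      refine (norm_add_le _ _).trans ?_
      have h1 := htriv (1 - δ) 1 (by linarith)
      have h2 := hpiece (c + δ) (1 - δ) (by linarith [hc.1]) h (by linarith) fun u hu => by
        rw [abs_of_nonneg (by linarith [hu.1])]; linarith [hu.1]
      linarith
  have hmid : ‖∫ u in (max 0 (c - δ))..(min 1 (c + δ)), E u‖ ≤ 2 * δ := by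
    refine (htriv _ _ ?_).trans ?_
    · exact max_le (le_min (by norm_num) (by linarith [hc.1]))
        (le_min (by linarith [hc.2]) (by linarith))
    · linarith [le_max_right 0 (c - δ), min_le_right 1 (c + δ)]
  rw [← intervalIntegral.integral_add_adjacent_intervals (hEi 0 (max 0 (c - δ))) (hEi _ 1),
    ← intervalIntegral.integral_add_adjacent_intervals (hEi (max 0 (c - δ)) (min 1 (c + δ)))
      (hEi _ 1)]
  refine (norm_add_le _ _).trans ((add_le_add le_rfl (norm_add_le _ _)).trans ?_)
  linarith

/-- Fubini: the product of the two characteristic functions is an expectation over an independent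
pair (y, z), and the exponents add up to the phase. -/
theorem quicksortOp_charFun_eq_integral (F : Measure ℝ) [IsProbabilityMeasure F] (t : ℝ) :
    quicksortOp (charFun F) t = ∫ p : ℝ × ℝ, (∫ u in (0 : ℝ)..1,
      Complex.exp ((t * quicksortPhase p.1 p.2 u : ℝ) * Complex.I)) ∂(F.prod F) := by
  have hcont : Continuous fun q : ℝ × ℝ × ℝ =>
      Complex.exp ((t * quicksortPhase q.2.1 q.2.2 q.1 : ℝ) * Complex.I) := by
    have : Continuous fun q : ℝ × ℝ × ℝ => quicksortPhase q.2.1 q.2.2 q.1 :=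
      continuous_quicksortPhase.comp
        (by fun_prop : Continuous fun q : ℝ × ℝ × ℝ => (q.2.1, q.2.2, q.1))
    fun_prop
  rw [← intervalIntegral_integral_swap]
  · refine intervalIntegral.integral_congr fun u _ => ?_
    simp only [charFun_apply_real]
    rw [← integral_prod_mul, ← integral_mul_const]
    refine integral_congr_ae (.of_forall fun p => ?_)
    simp only
    rw [← Complex.exp_add, ← Complex.exp_add, quicksortPhase]
    push_cast
    ring_nf
  · have : IsFiniteMeasure ((volume : Measure ℝ).restrict (Set.uIoc 0 1)) :=
      ⟨by simp [Set.uIoc_of_le]⟩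
    refine Integrable.of_bound (C := 1) hcont.aestronglyMeasurable (.of_forall fun q => ?_)
    exact (Complex.norm_exp_ofReal_mul_I _).le

theorem norm_quicksortOp_charFun_le (F : Measure ℝ) [IsProbabilityMeasure F] {t : ℝ} (ht : t ≠ 0) :
    ‖quicksortOp (charFun F) t‖ ≤ 6 * |t| ^ (-(1 / 2) : ℝ) := by
  rw [quicksortOp_charFun_eq_integral]
  have h := norm_integral_le_of_norm_le_const (μ := F.prod F) (C := 6 * |t| ^ (-(1 / 2) : ℝ))
    (f := fun p : ℝ × ℝ => ∫ u in (0 : ℝ)..1,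
      Complex.exp ((t * quicksortPhase p.1 p.2 u : ℝ) * Complex.I))
    (.of_forall fun p => norm_integral_exp_quicksortPhase_le p.1 p.2 ht)
  rwa [probReal_univ, mul_one] at h

/-! ### Bootstrapping the decay. -/

/-- One of u, 1-u is at least 1/2: the known decay of order p is used at that argument, at the cost
of 2^p, and decay of order 1/2 at the other. The remaining singularities u^(-1/2) and (1-u)^(-1/2)
are integrable, each with integral 2. -/
theorem norm_le_of_quicksortOp_fixedPoint {f : ℝ → ℂ} (hf : ∀ t, quicksortOp f t = f t)
    {c₁ c p : ℝ} (hc₁ : 0 ≤ c₁) (hc : 0 ≤ c) (hp : 0 ≤ p)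
    (h₁ : ∀ t, t ≠ 0 → ‖f t‖ ≤ c₁ * |t| ^ (-(1 / 2) : ℝ)) (h : ∀ t, t ≠ 0 → ‖f t‖ ≤ c * |t| ^ (-p))
    {t : ℝ} (ht : t ≠ 0) : ‖f t‖ ≤ 4 * c₁ * c * 2 ^ p * |t| ^ (-(p + 1 / 2)) := by
  have ht0 : 0 < |t| := abs_pos.2 ht
  have hhalf : ∀ a b : ℝ, 0 < a → 1 / 2 ≤ b →
      ‖f (a * t)‖ * ‖f (b * t)‖ ≤ c₁ * c * 2 ^ p * |t| ^ (-(p + 1 / 2)) * a ^ (-(1 / 2) : ℝ) := by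
    intro a b ha hb
    have hb0 : 0 < b := by linarith
    have e1 := h₁ (a * t) (mul_ne_zero ha.ne' ht)
    have e2 := h (b * t) (mul_ne_zero hb0.ne' ht)
    rw [abs_mul, abs_of_pos ha, Real.mul_rpow ha.le ht0.le] at e1
    rw [abs_mul, abs_of_pos hb0, Real.mul_rpow hb0.le ht0.le] at e2
    have e3 : b ^ (-p) ≤ 2 ^ p := by
      calc b ^ (-p) ≤ (1 / 2 : ℝ) ^ (-p) :=
            Real.rpow_le_rpow_of_nonpos (by norm_num) hb (by linarith)
        _ = 2 ^ p := by rw [one_div, Real.inv_rpow (by norm_num), Real.rpow_neg (by norm_num), inv_inv]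
    calc _ ≤ c₁ * (a ^ (-(1 / 2) : ℝ) * |t| ^ (-(1 / 2) : ℝ)) * (c * (2 ^ p * |t| ^ (-p))) := by
          refine mul_le_mul e1 (e2.trans ?_) (norm_nonneg _) (by positivity)
          gcongr
      _ = c₁ * c * 2 ^ p * (|t| ^ (-p) * |t| ^ (-(1 / 2) : ℝ)) * a ^ (-(1 / 2) : ℝ) := by ring
      _ = _ := by rw [← Real.rpow_add ht0]; ring_nf
  set D := c₁ * c * 2 ^ p * |t| ^ (-(p + 1 / 2)) with hD
  have hD0 : 0 ≤ D := by positivity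
  have hi : IntervalIntegrable (fun u : ℝ => u ^ (-(1 / 2) : ℝ)) volume 0 1 :=
    intervalIntegral.intervalIntegrable_rpow' (by norm_num)
  have hi' : IntervalIntegrable (fun u : ℝ => (1 - u) ^ (-(1 / 2) : ℝ)) volume 0 1 := by
    simpa using (hi.comp_sub_left 1).symm
  have hv : ∫ u in (0 : ℝ)..1, u ^ (-(1 / 2) : ℝ) = 2 := by
    rw [integral_rpow (Or.inl (by norm_num))]
    norm_num
  have hv' : ∫ u in (0 : ℝ)..1, (1 - u) ^ (-(1 / 2) : ℝ) = 2 := by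
    rw [intervalIntegral.integral_comp_sub_left (fun u => u ^ (-(1 / 2) : ℝ))]
    simpa using hv
  rw [← hf t, quicksortOp]
  calc _ ≤ ∫ u in (0 : ℝ)..1, D * (u ^ (-(1 / 2) : ℝ) + (1 - u) ^ (-(1 / 2) : ℝ)) := by
        refine intervalIntegral.norm_integral_le_of_norm_le zero_le_one ?_ ((hi.add hi').const_mul D)
        -- The integration set is (0, 1]; the endpoint 1, where 1 - u vanishes, is null.
        have hne : ∀ᵐ u : ℝ, u ≠ 1 := by simp [ae_iff]
        filter_upwards [hne] with u hu1 hu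
        have hu1 : u < 1 := lt_of_le_of_ne hu.2 hu1
        have hv0 : 0 < 1 - u := sub_pos.2 hu1
        have hu0 : 0 < u := hu.1
        rw [norm_mul, norm_mul, norm_exp_ofReal_mul_ofReal_mul_I, mul_one, mul_add]
        have p1 : 0 ≤ D * u ^ (-(1 / 2) : ℝ) := by positivity
        have p2 : 0 ≤ D * (1 - u) ^ (-(1 / 2) : ℝ) := by positivity
        rcases le_total u (1 / 2) with h2 | h2
        · linarith [hhalf u (1 - u) hu0 (by linarith)]
        · have := hhalf (1 - u) u hv0 h2
          rw [mul_comm] at this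
          linarith
    _ = 4 * c₁ * c * 2 ^ p * |t| ^ (-(p + 1 / 2)) := by
        rw [intervalIntegral.integral_const_mul, intervalIntegral.integral_add hi hi', hv, hv', hD]
        ring

/-- A characteristic function that solves the Quicksort recursion decays faster than any power. -/
theorem exists_norm_charFun_le_rpow {F : Measure ℝ} [IsProbabilityMeasure F]
    (hF : ∀ t, quicksortOp (charFun F) t = charFun F t) (k : ℕ) :
    ∃ c : ℝ, 0 ≤ c ∧ ∀ t, t ≠ 0 → ‖charFun F t‖ ≤ c * |t| ^ (-(k / 2 : ℝ)) := by
  have h₁ : ∀ t, t ≠ 0 → ‖charFun F t‖ ≤ 6 * |t| ^ (-(1 / 2) : ℝ) := fun t ht => by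
    rw [← hF]; exact norm_quicksortOp_charFun_le F ht
  induction k with
  | zero => exact ⟨1, zero_le_one, fun t _ => by simpa using norm_charFun_le_one t⟩
  | succ k ih =>
    obtain ⟨c, hc, h⟩ := ih
    refine ⟨4 * 6 * c * 2 ^ (k / 2 : ℝ), by positivity, fun t ht => ?_⟩
    have := norm_le_of_quicksortOp_fixedPoint hF (by norm_num) hc (by positivity) h₁ h ht
    convert! this using 3
    push_cast
    ring

/-! ### Decay of the derivatives. -/

/-- A rapidly decreasing function with bounded second derivative has a rapidly decreasing
derivative. -/
theorem rapidDecay_deriv_of_bounded_deriv_two {f f' f'' : ℝ → ℂ} (hf : ∀ t, HasDerivAt f (f' t) t)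
    (hf' : ∀ t, HasDerivAt f' (f'' t) t) {M : ℝ} (hM : ∀ t, ‖f'' t‖ ≤ M)
    (h : ∀ p : ℕ, ∃ c, ∀ t, (1 + |t|) ^ p * ‖f t‖ ≤ c) (p : ℕ) :
    ∃ c, ∀ t, (1 + |t|) ^ p * ‖f' t‖ ≤ c := by
  -- Landau's trick: with step η = (1+|t|)^(-p), decay of order 2p gives f = O(η²), and the Taylor
  -- error is also O(η²), so dividing by η leaves f' = O(η).
  obtain ⟨c, hc⟩ := h (2 * p)
  have hM0 : 0 ≤ M := (norm_nonneg _).trans (hM 0)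
  have hlip : ∀ s t, ‖f' s - f' t‖ ≤ M * |s - t| := fun s t =>
    convex_univ.norm_image_sub_le_of_norm_hasDerivWithin_le
      (fun x _ => (hf' x).hasDerivWithinAt) (fun x _ => hM x) (Set.mem_univ t) (Set.mem_univ s)
  have htaylor : ∀ t k : ℝ, ‖f (t + k) - f t - k * f' t‖ ≤ M * k ^ 2 := by
    intro t k
    have hseg : ∀ s ∈ Set.uIcc t (t + k), ‖f' s - f' t‖ ≤ M * |k| := by
      intro s hs
      refine (hlip s t).trans ?_
      refine mul_le_mul_of_nonneg_left ?_ hM0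
      simpa using Set.abs_sub_left_of_mem_uIcc hs
    have hd : ∀ s ∈ Set.uIcc t (t + k),
        HasDerivWithinAt (fun s : ℝ => f s - (s : ℂ) * f' t) (f' s - f' t)
          (Set.uIcc t (t + k)) s := by
      intro s _
      have h1 : HasDerivAt (fun s : ℝ => f s - (s : ℂ) * f' t) (f' s - f' t) s := by
        convert! (hf s).sub ((Complex.ofRealCLM.hasDerivAt (x := s)).mul_const (f' t)) using 1
        simp
      exact h1.hasDerivWithinAt
    have h1 := (convex_uIcc t (t + k)).norm_image_sub_le_of_norm_hasDerivWithin_le hd hseg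
      Set.left_mem_uIcc Set.right_mem_uIcc
    have h2 : f (t + k) - f t - k * f' t
        = f (t + k) - ((t + k : ℝ) : ℂ) * f' t - (f t - (t : ℂ) * f' t) := by
      push_cast; ring
    rw [h2]
    refine h1.trans_eq ?_
    rw [add_sub_cancel_left, Real.norm_eq_abs, mul_assoc, ← sq, sq_abs]
  refine ⟨2 * c + M, fun t => ?_⟩
  have hb0 : 0 < 1 + |t| := by positivity
  set η : ℝ := ((1 + |t|) ^ p)⁻¹ with hη
  have hη0 : 0 < η := by positivity
  have hfb : ∀ s, |t| ≤ |s| → ‖f s‖ ≤ c * η ^ 2 := by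
    intro s hs
    have h1 : (1 + |t|) ^ (2 * p) * ‖f s‖ ≤ c := le_trans (by gcongr) (hc s)
    have h2 : η ^ 2 = ((1 + |t|) ^ (2 * p))⁻¹ := by rw [hη, inv_pow, ← pow_mul, mul_comm p]
    rw [h2, ← div_eq_mul_inv, le_div_iff₀ (by positivity), mul_comm]
    exact h1
  -- The step points away from the origin, so the bound at t also holds at t + k.
  obtain ⟨k, hk, htk⟩ : ∃ k : ℝ, |k| = η ∧ |t| ≤ |t + k| := by
    rcases le_total 0 t with h0 | h0
    · exact ⟨η, abs_of_pos hη0, abs_le_abs_of_nonneg h0 (by linarith)⟩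
    · exact ⟨-η, by rw [abs_neg, abs_of_pos hη0], abs_le_abs_of_nonpos h0 (by linarith)⟩
  have h1 : η * ‖f' t‖ ≤ (2 * c + M) * η ^ 2 := by
    calc η * ‖f' t‖ = ‖(k : ℂ) * f' t‖ := by
          rw [norm_mul, Complex.norm_real, Real.norm_eq_abs, hk]
      _ = ‖f (t + k) - f t - (f (t + k) - f t - k * f' t)‖ := by congr 1; ring
      _ ≤ ‖f (t + k)‖ + ‖f t‖ + ‖f (t + k) - f t - k * f' t‖ :=
          (norm_sub_le _ _).trans (by gcongr; exact norm_sub_le _ _)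
      _ ≤ c * η ^ 2 + c * η ^ 2 + M * k ^ 2 := by
          gcongr
          · exact hfb _ htk
          · exact hfb _ le_rfl
          · exact htaylor t k
      _ = _ := by rw [← sq_abs k, hk]; ring
  have h2 : ‖f' t‖ ≤ (2 * c + M) * η := by
    refine le_of_mul_le_mul_left ?_ hη0
    exact h1.trans_eq (by ring)
  calc _ ≤ (1 + |t|) ^ p * ((2 * c + M) * η) := by gcongr
    _ = _ := by rw [hη]; field_simp

theorem norm_iteratedDeriv_charFun_le {F : Measure ℝ} [IsProbabilityMeasure F]
    (hm : ∀ k : ℕ, MemLp id k F) (k : ℕ) (t : ℝ) :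
    ‖iteratedDeriv k (charFun F) t‖ ≤ ∫ x, |x| ^ k ∂F := by
  rw [iteratedDeriv_charFun (hm k), norm_mul, norm_pow, Complex.norm_I, one_pow, one_mul]
  refine (norm_integral_le_integral_norm _).trans_eq ?_
  congr 1
  funext x
  rw [norm_mul, norm_exp_ofReal_mul_ofReal_mul_I, mul_one, norm_pow, Complex.norm_real,
    Real.norm_eq_abs]

/-- All derivatives of a characteristic function with finite moments that solves the Quicksort
recursion decay faster than any power. -/
theorem exists_pow_mul_norm_iteratedDeriv_charFun_le {F : Measure ℝ} [IsProbabilityMeasure F]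
    (hm : ∀ k : ℕ, MemLp id k F) (hF : ∀ t, quicksortOp (charFun F) t = charFun F t) (k p : ℕ) :
    ∃ c : ℝ, ∀ t, (1 + |t|) ^ p * ‖iteratedDeriv k (charFun F) t‖ ≤ c := by
  have hsmooth : ContDiff ℝ ∞ (charFun F) := contDiff_charFun' hm
  have hd : ∀ j t, HasDerivAt (iteratedDeriv j (charFun F)) (iteratedDeriv (j + 1) (charFun F) t)
      t := by
    intro j t
    rw [iteratedDeriv_succ]
    exact (hsmooth.differentiable_iteratedDeriv j (by exact_mod_cast WithTop.coe_lt_top j)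
      t).hasDerivAt
  induction k generalizing p with
  | zero =>
    obtain ⟨c, hc, h⟩ := exists_norm_charFun_le_rpow hF (2 * p)
    refine ⟨2 ^ p * (1 + c), fun t => ?_⟩
    rw [iteratedDeriv_zero]
    have h1 := norm_charFun_le_one (μ := F) t
    rcases le_total |t| 1 with ht | ht
    · calc (1 + |t|) ^ p * ‖charFun F t‖ ≤ (1 + 1) ^ p * 1 := by gcongr
        _ ≤ 2 ^ p * (1 + c) := by norm_num; exact hc
    · have ht0 : 0 < |t| := by linarith
      have h2 := h t (abs_pos.1 ht0)
      have h3 : |t| ^ (-((2 * p : ℕ) / 2 : ℝ)) = (|t| ^ p)⁻¹ := by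
        rw [← Real.rpow_natCast, ← Real.rpow_neg ht0.le]
        congr 1
        push_cast
        ring
      rw [h3] at h2
      calc (1 + |t|) ^ p * ‖charFun F t‖ ≤ (2 * |t|) ^ p * (c * (|t| ^ p)⁻¹) := by
            gcongr
            linarith
        _ = 2 ^ p * c := by rw [mul_pow]; field_simp
        _ ≤ 2 ^ p * (1 + c) := by gcongr; linarith
  | succ k ih =>
    exact rapidDecay_deriv_of_bounded_deriv_two (hd k) (hd (k + 1))
      (norm_iteratedDeriv_charFun_le hm (k + 1 + 1)) ih p

/-! ### The main theorem. -/

theorem theorem2p6 :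
    ∃ F : ProbabilityMeasure ℝ, IsQuicksortLimit F ∧
      ContDiff ℝ ∞ (charFun (F : Measure ℝ)) ∧
      (∀ p : ℝ, 0 ≤ p → ∀ k : ℕ, ∃ c : ℝ, ∀ t : ℝ, (t ≠ 0 ∨ p = 0) →
        ‖iteratedDeriv k (charFun (F : Measure ℝ)) t‖ ≤ c * |t| ^ (-p)) ∧
      ∃ φ : 𝓢(ℝ, ℂ), ∀ t : ℝ, φ t = charFun (F : Measure ℝ) t := by
  obtain ⟨F, hlim, hm, hF⟩ := exists_quicksortLimit
  have hdec := exists_pow_mul_norm_iteratedDeriv_charFun_le hm hF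
  have hsmooth : ContDiff ℝ ∞ (charFun (F : Measure ℝ)) := contDiff_charFun' hm
  refine ⟨F, hlim, hsmooth, fun p hp k => ?_, ⟨charFun (F : Measure ℝ), hsmooth, fun p k => ?_⟩,
    fun t => rfl⟩
  · obtain ⟨m, hpm⟩ := exists_nat_ge p
    obtain ⟨c, hc⟩ := hdec k m
    refine ⟨c, fun t ht => ?_⟩
    rcases ht with ht | rfl
    · have ht0 : 0 < |t| := abs_pos.2 ht
      rw [Real.rpow_neg ht0.le, ← div_eq_mul_inv, le_div_iff₀ (by positivity), mul_comm]
      refine le_trans ?_ (hc t)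
      gcongr
      calc |t| ^ p ≤ (1 + |t|) ^ p := by gcongr; linarith
        _ ≤ (1 + |t|) ^ (m : ℝ) := Real.rpow_le_rpow_of_exponent_le (by linarith) hpm
        _ = (1 + |t|) ^ m := Real.rpow_natCast _ _
    -- For p = 0 the right-hand side is the constant c, also at t = 0, because 0 ^ 0 = 1.
    · rw [neg_zero, Real.rpow_zero, mul_one]
      refine le_trans (le_mul_of_one_le_left (norm_nonneg _) ?_) (hc t)
      exact one_le_pow₀ (by linarith [abs_nonneg t])
  · obtain ⟨c, hc⟩ := hdec k p
    refine ⟨c, fun t => ?_⟩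
    rw [norm_iteratedFDeriv_eq_norm_iteratedDeriv, Real.norm_eq_abs]
    refine le_trans ?_ (hc t)
    gcongr
    linarith
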